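/- Consider a time-slotted system with $N\ge 1$ terminals and one base station. Let $\lambda_1,\dots,\lambda_N\in(0,1]$. At the end of each slot $t$ a packet arrives at terminal $n$ with probability $\lambda_n$ (indicator $L_n(t)$), independently over terminals and slots; it joins an initially empty queue of buffer size $B\in\{1,2,\dots\}\cup\{\infty\}$. At the beginning of each slot a policy $\pi$ decides which terminals are scheduled ($U_{n,\pi}(t)\in\{0,1\}$) and, by an arbitrary packet management, which packets are dropped and which packet from its queue a scheduled terminal transmits. A transmission succeeds iff no other terminal is scheduled in the same slot. The age of information (AoI) starts from arbitrary values and evolves as $$h_{n,\pi}(t+1)=h_{n,\pi}(t)-U_{n,\pi}(t)\prod_{m\ne n}\bigl(1-U_{m,\pi}(t)\bigr)\,g_n(t)+1,$$ where $g_n(t)=\max\{h_{n,\pi}(t)-a,\,0\}$ if the transmitted packet has age $a$ (the age of a packet that arrived at the end of the previous slot is $0$), and $g_n(t)=0$ if no packet is transmitted. Let $$\bar h_\pi^{(T,N)}=\frac1{TN}\sum_{t=1}^{T}\sum_{n=1}^{N}h_{n,\pi}(t),\qquad \bar h_\pi^{(\infty,N)}=\lim_{T\to\infty}\bar h_\pi^{(T,N)}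 .$$ A policy is an arrival-independent renewal (AIR) policy if (i) the scheduling intervals of all terminals (the times between successive slots in which a terminal is scheduled, together with the initial delays) are jointly independent of all the arrivals, and (ii) for each $n$ the scheduling times of terminal $n$ form a (possibly delayed) renewal process: almost surely the terminal is scheduled infinitely often, its initial delay and its intervals are independent, and the intervals are identically distributed with finite first and second moments. The joint law of the scheduling processes of different terminals is arbitrary. RR-ONE is the policy that schedules in each slot the terminal $\min\{n:\tau_n=\max_m\tau_m\}$, where $\tau_m$ is the time since terminal $m$ was last scheduled (with arbitrary initial values $\tau_m\ge1$), and in which each terminal retains only its last-arrived packet. **Theorem.** RR-ONE is an AIR policy; its time-average AoI exists almost surely as a limit and equals $$\bar h_{\mathsf{RR}}^{(\infty,N)}=\frac1N\sum_{n=1}^N\frac1{\lambda_n}+\frac{N-1}{2}\quad\text{almost surely};$$ and RR-ONE minimizes the time-average AoI among all AIR policies: for every AIR policy $\pi$, with any packet management, almost surely $$\liminf_{T\to\infty}\bar h_\pi^{(T,N)}\ \ge\ \frac1N\sum_{n=1}^N\frac1{\lambda_n}+\frac{N-1}{2}.$$ -/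

import Mathlib

open MeasureTheory ProbabilityTheory Filter Topology

/-! Time slots are indexed by `t : ℕ` (slot `0` is the first one), terminals by `Fin N`. In each slot
scheduling and transmission come first, then the arrivals. A packet is identified by its terminal and
by the slot in which it arrived. -/

namespace AoI

/-- `L n t ω` says whether a packet arrives at terminal `n` at the end of slot `t`: Bernoulli
variables with parameter `lam n`, independent over terminals and slots. -/
structure IsBernoulliArrivals {Ω : Type*} [MeasurableSpace Ω] (μ : Measure Ω) {N : ℕ}
    (lam : Fin N → ℝ) (L : Fin N → ℕ → Ω → Bool) : Prop where
  measurable : ∀ n t, Measurable (L n t)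
  law : ∀ n t, μ {ω | L n t ω = true} = ENNReal.ofReal (lam n)
  indep : iIndepFun (fun (p : Fin N × ℕ) => L p.1 p.2) μ

/-- The decisions that result from a policy: scheduling decisions, contents of the terminal queues
at the beginning of a slot (as sets of arrival slots), and the packet transmitted in a slot. -/
structure Policy (N : ℕ) (Ω : Type*) where
  /-- terminal `n` is scheduled in slot `t` -/
  sched : Fin N → ℕ → Ω → Bool
  /-- packets in the queue of terminal `n` at the beginning of slot `t` -/
  queue : Fin N → ℕ → Ω → Finset ℕ
  /-- packet transmitted by terminal `n` in slot `t`, if any -/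
  sent : Fin N → ℕ → Ω → Option ℕ

/-- `1` if terminal `n` is scheduled in slot `t` and no other terminal is (no collision), else `0`. -/
def Policy.success {N : ℕ} {Ω : Type*} (π : Policy N Ω) (n : Fin N) (t : ℕ) (ω : Ω) : ℕ :=
  (π.sched n t ω).toNat * ∏ m ∈ Finset.univ.erase n, (1 - (π.sched m t ω).toNat)

/-- Queue discipline with buffer size `B` and arbitrary packet management: queues start empty, only
packets in the queue of a scheduled terminal can be transmitted, delivered packets leave the queue,
any packet may be dropped at any time, and new packets enter only by arrivals. -/
structure Policy.IsAdmissible {N : ℕ} {Ω : Type*} [MeasurableSpace Ω]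
    (L : Fin N → ℕ → Ω → Bool) (B : ℕ∞) (π : Policy N Ω) : Prop where
  measurable_sched : ∀ n t, Measurable (π.sched n t)
  measurable_queue : ∀ n t s, MeasurableSet {ω | s ∈ π.queue n t ω}
  measurable_sent : ∀ n t s, MeasurableSet {ω | π.sent n t ω = some s}
  queue_zero : ∀ n ω, π.queue n 0 ω = ∅
  queue_succ : ∀ n t ω, ∀ s ∈ π.queue n (t + 1) ω,
    (s ∈ π.queue n t ω ∧ ¬ (π.success n t ω = 1 ∧ π.sent n t ω = some s)) ∨
      (s = t ∧ L n t ω = true)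
  queue_card : ∀ n t ω, ((π.queue n t ω).card : ℕ∞) ≤ B
  sent_mem : ∀ n t ω s, π.sent n t ω = some s → π.sched n t ω = true ∧ s ∈ π.queue n t ω

/-- Age, at the beginning of slot `t`, of a packet that arrived at the end of slot `s < t`. It is
zero for a packet that has just arrived. -/
def packetAge (s t : ℕ) : ℕ := t - (s + 1)

/-- Reduction of an AoI of value `h` in slot `t` by the delivery of the packet `p`; it is zero if
there is no packet, or if the packet is not fresher than what the base station already has. -/
def gain (h t : ℕ) (p : Option ℕ) : ℕ :=
  match p with
  | none => 0
  | some s => h - packetAge s t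

/-- The AoI of terminal `n` after `t` slots, with initial values `h0`. -/
def Policy.aoi {N : ℕ} {Ω : Type*} (h0 : Fin N → ℕ) (π : Policy N Ω) (n : Fin N) :
    ℕ → Ω → ℕ
  | 0, _ => h0 n
  | t + 1, ω =>
    π.aoi h0 n t ω - π.success n t ω * gain (π.aoi h0 n t ω) t (π.sent n t ω) + 1

/-- The `T`-horizon time-average AoI, averaged over the terminals. -/
noncomputable def Policy.avgAoI {N : ℕ} {Ω : Type*} (h0 : Fin N → ℕ) (π : Policy N Ω)
    (T : ℕ) (ω : Ω) : ℝ :=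
  1 / ((T : ℝ) * (N : ℝ)) * ∑ t ∈ Finset.Icc 1 T, ∑ n : Fin N, (π.aoi h0 n t ω : ℝ)

/-- The slot in which terminal `n` is scheduled for the `k`-th time (`k = 0` is the first time). -/
noncomputable def Policy.schedTime {N : ℕ} {Ω : Type*} (π : Policy N Ω) (n : Fin N) (k : ℕ)
    (ω : Ω) : ℕ :=
  Nat.nth (fun t => π.sched n t ω = true) k

/-- The scheduling intervals of terminal `n`: `interval n 0` is the initial delay, and for `k ≥ 1`
`interval n k` is the time between two successive scheduling times. -/
noncomputable def Policy.interval {N : ℕ} {Ω : Type*} (π : Policy N Ω) (n : Fin N) :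
    ℕ → Ω → ℕ
  | 0, ω => π.schedTime n 0 ω
  | k + 1, ω => π.schedTime n (k + 1) ω - π.schedTime n k ω

/-- Arrival-independent renewal policies: for every terminal the scheduling times form a (possibly
delayed) renewal process whose intervals have finite first and second moments, and the scheduling
intervals of all terminals are jointly independent of all arrivals. The joint law of the scheduling
processes of different terminals is arbitrary. -/
structure Policy.IsAIR {N : ℕ} {Ω : Type*} [MeasurableSpace Ω] (μ : Measure Ω)
    (L : Fin N → ℕ → Ω → Bool) (π : Policy N Ω) : Prop where
  infinite : ∀ n, ∀ᵐ ω ∂μ, {t | π.sched n t ω = true}.Infinite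
  indep_interval : ∀ n, iIndepFun (fun k => π.interval n k) μ
  identDistrib : ∀ n k, IdentDistrib (π.interval n (k + 1)) (π.interval n 1) μ μ
  moments : ∀ n, Integrable (fun ω => (π.interval n 1 ω : ℝ)) μ ∧
    Integrable (fun ω => (π.interval n 1 ω : ℝ) ^ 2) μ
  indep_arrivals : IndepFun (fun ω (p : Fin N × ℕ) => π.interval p.1 p.2 ω)
    (fun ω (p : Fin N × ℕ) => L p.1 p.2 ω) μ

lemma exists_eq_sup {N : ℕ} [NeZero N] (τ : Fin N → ℕ) :
    (Finset.univ.filter (fun n => τ n = Finset.univ.sup τ)).Nonempty := by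
  obtain ⟨n, -, hn⟩ := Finset.exists_mem_eq_sup Finset.univ Finset.univ_nonempty τ
  exact ⟨n, by simp [hn]⟩

/-- `min {n : τ n = max τ}`. -/
def rrIndex {N : ℕ} [NeZero N] (τ : Fin N → ℕ) : Fin N :=
  (Finset.univ.filter (fun n => τ n = Finset.univ.sup τ)).min' (exists_eq_sup τ)

/-- The time since the last update of each terminal under round robin, at the beginning of slot `t`;
`τ0` are the initial values. -/
def rrTau {N : ℕ} [NeZero N] (τ0 : Fin N → ℕ) : ℕ → Fin N → ℕ
  | 0 => τ0
  | t + 1 => fun n => if n = rrIndex (rrTau τ0 t) then 1 else rrTau τ0 t n + 1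

/-- The one-packet buffer of terminal `n` under round robin: a new packet replaces the old one, and
the buffer is emptied when the terminal is scheduled. -/
def rrBuffer {N : ℕ} [NeZero N] {Ω : Type*} (L : Fin N → ℕ → Ω → Bool) (τ0 : Fin N → ℕ)
    (n : Fin N) : ℕ → Ω → Option ℕ
  | 0, _ => none
  | t + 1, ω =>
    if L n t ω = true then some t
    else if n = rrIndex (rrTau τ0 t) then none
    else rrBuffer L τ0 n t ω

/-- RR-ONE: schedule the terminal with the largest time since its last update (the one with the
smallest index among those), with latest-only one-packet buffers. -/
def rrOne {N : ℕ} [NeZero N] {Ω : Type*} (L : Fin N → ℕ → Ω → Bool) (τ0 : Fin N → ℕ) :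
    Policy N Ω where
  sched := fun n t _ => decide (n = rrIndex (rrTau τ0 t))
  queue := fun n t ω => (rrBuffer L τ0 n t ω).toFinset
  sent := fun n t ω => if n = rrIndex (rrTau τ0 t) then rrBuffer L τ0 n t ω else none

end AoI

/-! Fix a sample path. Let d_n(t) be the number of slots since terminal n last transmitted alone
(counted from slot 0 before that), and A_n(t) the age of its latest arrival, started at the initial
AoI. Under any packet management the AoI is at least d_n(t) + A_n(t - d_n(t)), because a success
delivers nothing fresher than the latest arrival (`Policy.IsAdmissible.le_aoi`). RR-ONE attains this
value (`rrOne_aoi_le`).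

The two terms are averaged separately. At most one terminal succeeds per slot, so at most j of the
d_n(t) are ≤ j, and their sum is at least 1 + ... + N once t ≥ N (`le_sum_elapsed`). Under RR-ONE
the d_n(t) also sum to at most this (`sum_rrTau_le`).

The process A_n is a Markov chain that restarts at 0 with probability λ_n, so its deviations from (1
- λ_n)/λ_n have correlations decaying like (1 - λ_n)^k. The schedule is a function of the intervals,
hence independent of the arrivals. For each fixed j, a law of large numbers with the indicators of
d_n = j as weights therefore shows that the deviations average to 0 (`Policy.IsAIR.ae_tendsto_dev`).
The limiting value is (N + 1)/2 plus the mean of (1 - λ_n)/λ_n, which is the claimed one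
(`sum_inv_eq`). For general policies d_n may be unbounded, so the lower bound truncates at a large
level M; for RR-ONE d_n ≤ N and finitely many j suffice. -/

namespace AoI

/-! ### Strong laws from second moments -/

section LLN

variable {Ω : Type*} [MeasurableSpace Ω] {μ : Measure Ω}

/-- The sum of the `f k` has finite integral, so the series converges almost everywhere and its
terms vanish. -/
lemma ae_tendsto_zero_of_summable_integral {f : ℕ → Ω → ℝ} (hf : ∀ k, Integrable (f k) μ)
    (h0 : ∀ k ω, 0 ≤ f k ω) (hs : Summable fun k => ∫ ω, f k ω ∂μ) :
    ∀ᵐ ω ∂μ, Tendsto (fun k => f k ω) atTop (𝓝 0) := by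
  have h1 : ∀ k, eLpNorm (f k) 1 μ = ENNReal.ofReal (∫ ω, f k ω ∂μ) := fun k => by
    rw [eLpNorm_one_eq_lintegral_enorm, ← ofReal_integral_norm_eq_lintegral_enorm (hf k)]
    congr 2
    exact funext fun ω => Real.norm_of_nonneg (h0 k ω)
  have h2 := summable_norm_of_tsum_eLpNorm_ne_top (p := 1) le_rfl
    (fun k => (hf k).aestronglyMeasurable) (by simp_rw [h1]; exact hs.tsum_ofReal_ne_top)
  filter_upwards [h2] with ω hω
  exact tendsto_zero_iff_norm_tendsto_zero.2 hω.tendsto_atTop_zero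

lemma sq_sum_le_card_mul {ι : Type*} (s : Finset ι) (f : ι → ℝ) :
    (∑ i ∈ s, |f i|) ^ 2 ≤ s.card * ∑ i ∈ s, f i ^ 2 := by
  simpa [sq_abs] using sq_sum_le_card_mul_sum_sq (s := s) (f := fun i => |f i|)

/-- A strong law of large numbers for square-integrable variables whose partial sums have second
moments of linear growth. -/
theorem ae_tendsto_average_zero {Z : ℕ → Ω → ℝ} {C : ℝ} (hZ : ∀ t, MemLp (Z t) 2 μ)
    (h1 : ∀ t, ∫ ω, Z t ω ^ 2 ∂μ ≤ C)
    (h2 : ∀ T : ℕ, ∫ ω, (∑ t ∈ Finset.range T, Z t ω) ^ 2 ∂μ ≤ C * T) :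
    ∀ᵐ ω ∂μ, Tendsto (fun T : ℕ => (∑ t ∈ Finset.range T, Z t ω) / T) atTop (𝓝 0) := by
  have hC : 0 ≤ C := (integral_nonneg fun ω => sq_nonneg _).trans (h1 0)
  let S : ℕ → Ω → ℝ := fun T ω => ∑ t ∈ Finset.range T, Z t ω
  let D : ℕ → Ω → ℝ := fun k ω => ∑ t ∈ Finset.Ico (k ^ 2) ((k + 1) ^ 2), |Z t ω|
  have hS : ∀ T, MemLp (S T) 2 μ := fun T => memLp_finsetSum _ fun t _ => hZ t
  have hD : ∀ k, MemLp (D k) 2 μ := fun k => memLp_finsetSum _ fun t _ => (hZ t).abs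
  have hcard : ∀ k : ℕ, ((Finset.Ico (k ^ 2) ((k + 1) ^ 2)).card : ℝ) = 2 * k + 1 := fun k => by
    rw [Nat.card_Ico, Nat.cast_sub (by gcongr; omega)]
    push_cast; ring
  have hDi : ∀ k : ℕ, ∫ ω, D k ω ^ 2 ∂μ ≤ C * (2 * k + 1) ^ 2 := fun k => by
    calc ∫ ω, D k ω ^ 2 ∂μ
        ≤ ∫ ω, (2 * k + 1 : ℝ) * ∑ t ∈ Finset.Ico (k ^ 2) ((k + 1) ^ 2), Z t ω ^ 2 ∂μ := by
          refine integral_mono (hD k).integrable_sq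
            ((integrable_finsetSum _ fun t _ => (hZ t).integrable_sq).const_mul _) fun ω => ?_
          rw [← hcard]
          exact sq_sum_le_card_mul _ _
      _ = (2 * k + 1 : ℝ) * ∑ t ∈ Finset.Ico (k ^ 2) ((k + 1) ^ 2), ∫ ω, Z t ω ^ 2 ∂μ := by
          rw [integral_const_mul, integral_finsetSum _ fun t _ => (hZ t).integrable_sq]
      _ ≤ (2 * k + 1 : ℝ) * ∑ t ∈ Finset.Ico (k ^ 2) ((k + 1) ^ 2), C := by
          gcongr with t _
          exact h1 t
      _ = C * (2 * k + 1) ^ 2 := by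
          rw [Finset.sum_const, nsmul_eq_mul, hcard]; ring
  -- Partial sums up to k² and absolute sums over the block from k² to (k + 1)², divided by k², both
  -- have second moments O(1/k²). The factor 10 below is 1 + 9, from (2k + 1)² ≤ 9k².
  let F : ℕ → Ω → ℝ := fun k ω => (S (k ^ 2) ω ^ 2 + D k ω ^ 2) / (k : ℝ) ^ 4
  have hF : ∀ k, Integrable (F k) μ := fun k =>
    ((hS _).integrable_sq.add (hD k).integrable_sq).div_const _
  have hF0 : ∀ k ω, 0 ≤ F k ω := fun k ω => by positivity
  have hFi : ∀ k : ℕ, ∫ ω, F k ω ∂μ ≤ 10 * C * (1 / (k : ℝ) ^ 2) := fun k => by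
    simp only [F]
    rw [integral_div, integral_add (hS _).integrable_sq (hD k).integrable_sq]
    rcases Nat.eq_zero_or_pos k with rfl | hk
    · simp
    have hk1 : (1 : ℝ) ≤ k := by exact_mod_cast hk
    rw [div_le_iff₀ (by positivity)]
    have e1 := h2 (k ^ 2)
    have e2 := hDi k
    have e3 : C * (2 * k + 1 : ℝ) ^ 2 ≤ C * (9 * (k : ℝ) ^ 2) := by
      gcongr; nlinarith
    have e4 : 10 * C * (1 / (k : ℝ) ^ 2) * (k : ℝ) ^ 4 = C * (k : ℝ) ^ 2 + C * (9 * (k : ℝ) ^ 2) := by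
      field_simp; ring
    push_cast at e1
    rw [e4]
    simp only [S]
    linarith
  have hFs : Summable fun k => ∫ ω, F k ω ∂μ :=
    Summable.of_nonneg_of_le (fun k => integral_nonneg (hF0 k)) hFi
      ((Real.summable_one_div_nat_pow.2 one_lt_two).mul_left _)
  filter_upwards [ae_tendsto_zero_of_summable_integral hF hF0 hFs] with ω hω
  have hsq : Tendsto (fun T : ℕ => 2 * √(F (Nat.sqrt T) ω)) atTop (𝓝 0) := by
    have h3 : Tendsto Nat.sqrt atTop atTop := tendsto_atTop_atTop.2 fun b =>
      ⟨b ^ 2, fun a ha => Nat.le_sqrt'.2 ha⟩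
    simpa using ((hω.comp h3).sqrt).const_mul 2
  refine squeeze_zero_norm' ?_ hsq
  filter_upwards [eventually_ge_atTop 1] with T hT
  -- A general T lies in the block between k² and (k + 1)².
  set k := Nat.sqrt T with hk
  have hk1 : 1 ≤ k := Nat.le_sqrt'.2 (by simpa using hT)
  have hk2 : k ^ 2 ≤ T := Nat.sqrt_le' T
  have hk3 : T < (k + 1) ^ 2 := Nat.lt_succ_sqrt' T
  have hkp : (0 : ℝ) < (k : ℝ) ^ 2 := by positivity
  have hb : |∑ t ∈ Finset.range T, Z t ω| ≤ |S (k ^ 2) ω| + D k ω := by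
    have : ∑ t ∈ Finset.range T, Z t ω = S (k ^ 2) ω + ∑ t ∈ Finset.Ico (k ^ 2) T, Z t ω :=
      (Finset.sum_range_add_sum_Ico _ hk2).symm
    rw [this]
    refine (abs_add_le _ _).trans ?_
    gcongr
    refine (Finset.abs_sum_le_sum_abs _ _).trans ?_
    exact Finset.sum_le_sum_of_subset_of_nonneg (Finset.Ico_subset_Ico_right hk3.le)
      fun _ _ _ => abs_nonneg _
  have hD0 : 0 ≤ D k ω := Finset.sum_nonneg fun _ _ => abs_nonneg _
  have hroot : ∀ x : ℝ, 0 ≤ x → x ^ 2 ≤ S (k ^ 2) ω ^ 2 + D k ω ^ 2 →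
      x / (k : ℝ) ^ 2 ≤ √(F k ω) := fun x hx hle => by
    refine Real.le_sqrt_of_sq_le ?_
    rw [div_pow, ← pow_mul]
    simp only [F]
    gcongr
  have r1 := hroot |S (k ^ 2) ω| (abs_nonneg _) (by rw [sq_abs]; nlinarith [sq_nonneg (D k ω)])
  have r2 := hroot (D k ω) hD0 (by nlinarith [sq_nonneg (S (k ^ 2) ω)])
  rw [Real.norm_eq_abs, abs_div, Nat.abs_cast]
  calc |∑ t ∈ Finset.range T, Z t ω| / T ≤ (|S (k ^ 2) ω| + D k ω) / (k : ℝ) ^ 2 := by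
        gcongr
        exact_mod_cast hk2
    _ ≤ 2 * √(F k ω) := by rw [add_div]; linarith

/-- Exponentially decaying correlations suffice for the strong law of large numbers. -/
theorem ae_tendsto_average_zero_of_covariance {Z : ℕ → Ω → ℝ} {V q : ℝ} (hq0 : 0 ≤ q) (hq1 : q < 1)
    (hZ : ∀ t, MemLp (Z t) 2 μ)
    (hcov : ∀ s t, s ≤ t → ∫ ω, Z s ω * Z t ω ∂μ ≤ V * q ^ (t - s)) :
    ∀ᵐ ω ∂μ, Tendsto (fun T : ℕ => (∑ t ∈ Finset.range T, Z t ω) / T) atTop (𝓝 0) := by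
  have hsq : ∀ t, ∫ ω, Z t ω ^ 2 ∂μ ≤ V := fun t => by simpa [sq] using hcov t t le_rfl
  have hV : 0 ≤ V := (integral_nonneg fun ω => sq_nonneg _).trans (hsq 0)
  have hr : 0 < 1 - q := by linarith
  have hVC : V ≤ V * (1 + 2 / (1 - q)) := le_mul_of_one_le_right hV (by
    have : 0 ≤ 2 / (1 - q) := by positivity
    linarith)
  have hgeo : ∀ T : ℕ, ∑ s ∈ Finset.range T, q ^ (T - s) ≤ 1 / (1 - q) := fun T => by
    calc ∑ s ∈ Finset.range T, q ^ (T - s) = ∑ s ∈ Finset.range T, q ^ (s + 1) := by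
          rw [← Finset.sum_range_reflect]
          refine Finset.sum_congr rfl fun s hs => ?_
          have := Finset.mem_range.1 hs
          congr 1; omega
      _ ≤ ∑ s ∈ Finset.range T, q ^ s := by
          refine Finset.sum_le_sum fun s _ => pow_le_pow_of_le_one hq0 hq1.le (Nat.le_succ s)
      _ ≤ 1 / (1 - q) := by
          rw [one_div, ← tsum_geometric_of_lt_one hq0 hq1]
          exact (summable_geometric_of_lt_one hq0 hq1).sum_le_tsum _ fun i _ => by positivity
  -- Passing from T to T + 1 adds a square, at most V, and twice the cross terms, at most V / (1 -
  -- q) by the geometric series.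
  refine ae_tendsto_average_zero (C := V * (1 + 2 / (1 - q))) hZ (fun t => (hsq t).trans hVC)
    fun T => ?_
  induction T with
  | zero => simp
  | succ T ih =>
    have hS : MemLp (fun ω => ∑ t ∈ Finset.range T, Z t ω) 2 μ := memLp_finsetSum _ fun t _ => hZ t
    have hi : ∀ s, Integrable (fun ω => Z s ω * Z T ω) μ := fun s => (hZ s).integrable_mul (hZ T)
    have e : ∀ ω, (∑ t ∈ Finset.range (T + 1), Z t ω) ^ 2 =
        (∑ t ∈ Finset.range T, Z t ω) ^ 2 + 2 * ∑ s ∈ Finset.range T, Z s ω * Z T ω + Z T ω ^ 2 :=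
      fun ω => by rw [Finset.sum_range_succ, ← Finset.sum_mul]; ring
    simp_rw [e]
    have hi2 : Integrable (fun ω => 2 * ∑ s ∈ Finset.range T, Z s ω * Z T ω) μ :=
      (integrable_finsetSum _ fun s _ => hi s).const_mul _
    have hi3 : Integrable (fun ω => (∑ t ∈ Finset.range T, Z t ω) ^ 2 +
        2 * ∑ s ∈ Finset.range T, Z s ω * Z T ω) μ := hS.integrable_sq.add hi2
    rw [integral_add hi3 (hZ T).integrable_sq,
      integral_add hS.integrable_sq hi2, integral_const_mul, integral_finsetSum _ fun s _ => hi s]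
    have hc : ∑ s ∈ Finset.range T, ∫ ω, Z s ω * Z T ω ∂μ ≤ V * (1 / (1 - q)) := by
      calc _ ≤ ∑ s ∈ Finset.range T, V * q ^ (T - s) :=
            Finset.sum_le_sum fun s hs => hcov s T (Finset.mem_range.1 hs).le
        _ ≤ _ := by
            rw [← Finset.mul_sum]
            exact mul_le_mul_of_nonneg_left (hgeo T) hV
    have := hsq T
    push_cast
    have e2 : V * (1 + 2 / (1 - q)) * (T + 1) =
      V * (1 + 2 / (1 - q)) * T + 2 * (V * (1 / (1 - q))) + V := by ring
    linarith

end LLN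

/-! ### Elapsed times and ages along a path -/

/-- Time since the last slot before `t` in which `s` holds, `x0` being the value at time `0`. -/
def elapsed (x0 : ℕ) (s : ℕ → Bool) : ℕ → ℕ
  | 0 => x0
  | t + 1 => if s t then 1 else elapsed x0 s t + 1

/-- Age, at the beginning of a slot, of the last arrived packet, with initial value `a0`. -/
def latestAge (a0 : ℕ) (x : ℕ → Bool) : ℕ → ℕ
  | 0 => a0
  | t + 1 => if x t then 0 else latestAge a0 x t + 1

/-- Terminal `n` is the only one that is scheduled in slot `t`. -/
def solo {N : ℕ} (u : Fin N → ℕ → Bool) (n : Fin N) (t : ℕ) : Bool :=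
  decide (u n t = true ∧ ∀ m, m ≠ n → u m t = false)

lemma elapsed_le (x0 : ℕ) (s : ℕ → Bool) (t : ℕ) : elapsed x0 s t ≤ x0 + t := by
  induction t with
  | zero => simp [elapsed]
  | succ t ih => simp only [elapsed]; split <;> omega

lemma elapsed_zero_le (s : ℕ → Bool) (t : ℕ) : elapsed 0 s t ≤ t := by
  simpa using elapsed_le 0 s t

lemma elapsed_mono {x y : ℕ} (hxy : x ≤ y) (s : ℕ → Bool) (t : ℕ) :
    elapsed x s t ≤ elapsed y s t := by
  induction t with
  | zero => simpa [elapsed]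
  | succ t ih => simp only [elapsed]; split <;> omega

lemma latestAge_le (a0 : ℕ) (x : ℕ → Bool) (t : ℕ) : latestAge a0 x t ≤ a0 + t := by
  induction t with
  | zero => simp [latestAge]
  | succ t ih => simp only [latestAge]; split <;> omega

lemma latestAge_add_le (a0 : ℕ) (x : ℕ → Bool) (t k : ℕ) :
    latestAge a0 x (t + k) ≤ latestAge a0 x t + k := by
  induction k with
  | zero => simp
  | succ k ih =>
    rw [← add_assoc, latestAge]
    split <;> omega

/-- The arrival at `p` resets the age to 0, and it then grows by at most one per slot. Hence no
packet is fresher than the latest arrival. -/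
lemma latestAge_le_packetAge (a0 : ℕ) {x : ℕ → Bool} {p t : ℕ} (hp : x p = true) (hpt : p < t) :
    latestAge a0 x t ≤ packetAge p t := by
  obtain ⟨k, rfl⟩ := Nat.exists_eq_add_of_lt hpt
  have h := latestAge_add_le a0 x (p + 1) k
  have h' : latestAge a0 x (p + 1) = 0 := by simp [latestAge, hp]
  have e : p + k + 1 = p + 1 + k := by ring
  rw [packetAge, e]
  omega

/-! ### At most one success per slot: counting -/

section Counting

variable {N : ℕ} {u : Fin N → ℕ → Bool}

lemma solo_unique {n m : Fin N} {t : ℕ} (hn : solo u n t = true) (hm : solo u m t = true) :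
    n = m := by
  simp only [solo, decide_eq_true_eq] at hn hm
  by_contra h
  have := hm.2 n h
  simp [hn.1] at this

/-- If in each slot `s n` holds for at most one `n`, then at most `j` of the elapsed times are
at most `j`. -/
lemma card_elapsed_le {s : Fin N → ℕ → Bool} (hs : ∀ t n m, s n t = true → s m t = true → n = m)
    {x0 : Fin N → ℕ} {x : ℕ} (hx : ∀ n, x ≤ x0 n) (t j : ℕ) (hj : j < t + x) :
    (Finset.univ.filter fun n => elapsed (x0 n) (s n) t ≤ j).card ≤ j := by
  induction t generalizing j with
  | zero =>
    have : (Finset.univ.filter fun n => elapsed (x0 n) (s n) 0 ≤ j) = ∅ :=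
      Finset.filter_eq_empty_iff.2 fun n _ => by
        have := hx n
        simp only [elapsed]; omega
    rw [this]; simp
  | succ t ih =>
    rcases Nat.eq_zero_or_pos j with rfl | hj0
    · have : (Finset.univ.filter fun n => elapsed (x0 n) (s n) (t + 1) ≤ 0) = ∅ :=
        Finset.filter_eq_empty_iff.2 fun n _ => by
          simp only [elapsed]; split <;> simp
      rw [this]; simp
    obtain ⟨j, rfl⟩ := Nat.exists_eq_add_of_le' hj0
    -- An elapsed time ≤ j + 1 was either ≤ j one slot earlier or has just been reset, and at most
    -- one terminal is reset.
    have hsub : (Finset.univ.filter fun n => elapsed (x0 n) (s n) (t + 1) ≤ j + 1) ⊆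
        (Finset.univ.filter fun n => elapsed (x0 n) (s n) t ≤ j) ∪
          (Finset.univ.filter fun n => s n t = true) := by
      intro n
      rw [Finset.mem_union, Finset.mem_filter_univ, Finset.mem_filter_univ, Finset.mem_filter_univ,
        elapsed]
      split
      · simp_all
      · intro h; left; omega
    refine (Finset.card_le_card hsub).trans ((Finset.card_union_le _ _).trans ?_)
    have h1 : (Finset.univ.filter fun n => s n t = true).card ≤ 1 :=
      Finset.card_le_one.2 fun n hn m hm => hs t n m (by simpa using hn) (by simpa using hm)
    have h2 := ih j (by omega)
    omega

/-- Double counting: `d n` is the number of levels j below `d n`. The equality below needs `M` to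
exceed no such level. -/
lemma sum_range_card_lt_le (d : Fin N → ℕ) (M : ℕ) :
    ∑ j ∈ Finset.range M, (Finset.univ.filter fun n => j < d n).card ≤ ∑ n, d n := by
  simp_rw [Finset.card_filter]
  rw [Finset.sum_comm]
  refine Finset.sum_le_sum fun n _ => ?_
  rw [← Finset.card_filter]
  calc _ ≤ (Finset.range (d n)).card := Finset.card_le_card fun j => by simp
    _ = _ := by simp

lemma sum_range_card_lt (d : Fin N → ℕ) (M : ℕ) (hM : ∀ n, d n ≤ M) :
    ∑ j ∈ Finset.range M, (Finset.univ.filter fun n => j < d n).card = ∑ n, d n := by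
  simp_rw [Finset.card_filter]
  rw [Finset.sum_comm]
  refine Finset.sum_congr rfl fun n _ => ?_
  rw [← Finset.card_filter]
  have : (Finset.range M).filter (fun j => j < d n) = Finset.range (d n) := by
    ext j
    have := hM n
    simp; omega
  simp [this]

lemma sum_range_sub_real (N : ℕ) :
    ((∑ j ∈ Finset.range N, (N - j) : ℕ) : ℝ) = N * (N + 1) / 2 := by
  induction N with
  | zero => simp
  | succ N ih =>
    have h : ∑ j ∈ Finset.range N, (N + 1 - (j + 1)) = ∑ j ∈ Finset.range N, (N - j) :=
      Finset.sum_congr rfl fun j _ => Nat.add_sub_add_right _ _ _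
    rw [Finset.sum_range_succ', h, Nat.cast_add, ih]
    push_cast
    ring

/-- At least N - j elapsed times exceed j, for each j < N; summing over the levels j gives N + (N -
1) + ... + 1. -/
lemma le_sum_elapsed {s : Fin N → ℕ → Bool}
    (hs : ∀ t n m, s n t = true → s m t = true → n = m) {t : ℕ} (ht : N ≤ t) :
    (N * (N + 1) / 2 : ℝ) ≤ ∑ n, (elapsed 0 (s n) t : ℝ) := by
  rw [← sum_range_sub_real]
  norm_cast
  refine le_trans ?_ (sum_range_card_lt_le _ N)
  refine Finset.sum_le_sum fun j hj => ?_
  have hj := Finset.mem_range.1 hj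
  have h1 := card_elapsed_le hs (x0 := fun _ => 0) (x := 0) (fun _ => le_rfl) t j (by omega)
  have h2 := Finset.card_filter_add_card_filter_not (s := Finset.univ)
    (fun n : Fin N => elapsed 0 (s n) t ≤ j)
  simp only [not_le, Finset.card_univ, Fintype.card_fin] at h2
  omega

end Counting

/-! ### Pathwise lower bound on the AoI -/

section Pathwise

variable {Ω : Type*} {N : ℕ}

lemma Policy.success_eq (π : Policy N Ω) (n : Fin N) (t : ℕ) (ω : Ω) :
    π.success n t ω = (solo (fun m t => π.sched m t ω) n t).toNat := by
  by_cases h : solo (fun m t => π.sched m t ω) n t = true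
  · rw [h]
    simp only [solo, decide_eq_true_eq] at h
    rw [Policy.success, h.1, Finset.prod_eq_one]
    · rfl
    · intro m hm
      rw [h.2 m (Finset.ne_of_mem_erase hm)]
      rfl
  · rw [Bool.not_eq_true] at h
    rw [h]
    simp only [solo, decide_eq_false_iff_not, not_and_or, not_forall] at h
    rcases h with h | ⟨m, hm, h⟩
    · simp [Policy.success, h]
    · rw [Policy.success, Finset.prod_eq_zero (i := m)]
      · rfl
      · simpa using hm
      · simp only [Bool.not_eq_false] at h
        simp [h]

variable [MeasurableSpace Ω]

lemma Policy.IsAdmissible.lt_of_mem_queue {L : Fin N → ℕ → Ω → Bool} {B : ℕ∞} {π : Policy N Ω}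
    (hπ : π.IsAdmissible L B) {n : Fin N} {t : ℕ} {ω : Ω} {p : ℕ} (hp : p ∈ π.queue n t ω) :
    p < t ∧ L n p ω = true := by
  induction t with
  | zero => simp [hπ.queue_zero] at hp
  | succ t ih =>
    rcases hπ.queue_succ n t ω p hp with h | ⟨rfl, h⟩
    · exact ⟨(ih h.1).1.trans (Nat.lt_succ_self t), (ih h.1).2⟩
    · exact ⟨Nat.lt_succ_self p, h⟩

/-- The age of information is at least the one of a terminal that always delivers its last arrived
packet when it is the only scheduled terminal. -/
lemma Policy.IsAdmissible.le_aoi {L : Fin N → ℕ → Ω → Bool} {B : ℕ∞} {π : Policy N Ω}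
    (hπ : π.IsAdmissible L B) (h0 : Fin N → ℕ) (n : Fin N) (t : ℕ) (ω : Ω) :
    elapsed 0 (solo (fun m t => π.sched m t ω) n) t +
      latestAge (h0 n) (fun t => L n t ω)
        (t - elapsed 0 (solo (fun m t => π.sched m t ω) n) t) ≤ π.aoi h0 n t ω := by
  induction t with
  | zero => simp [elapsed, latestAge, Policy.aoi]
  | succ t ih =>
    set s := solo (fun m t => π.sched m t ω) n with hs
    set x := fun t => L n t ω
    have hd := elapsed_zero_le s t
    -- With the induction hypothesis, this shows that the AoI is at least the latest age at `t`. A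
    -- success leaves the minimum of the AoI and the age of the packet, so it cannot go below that
    -- age.
    have hstep := latestAge_add_le (h0 n) x (t - elapsed 0 s t) (elapsed 0 s t)
    rw [Nat.sub_add_cancel hd] at hstep
    simp only [Policy.aoi, Policy.success_eq, ← hs, elapsed]
    by_cases h : s t = true
    · rw [h]
      simp only [if_true, Nat.add_sub_cancel, Bool.toNat_true, one_mul]
      rcases hsent : π.sent n t ω with _ | p
      · simp only [gain]; omega
      · obtain ⟨hp1, hp2⟩ := hπ.lt_of_mem_queue (hπ.sent_mem n t ω p hsent).2
        have := latestAge_le_packetAge (x := x) (h0 n) hp2 hp1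
        simp only [gain]; omega
    · rw [Bool.not_eq_true] at h
      simp only [h, Bool.toNat_false, zero_mul, Nat.sub_zero, Bool.false_eq_true, if_false]
      rw [Nat.add_sub_add_right]
      omega

end Pathwise

/-! ### Age of the latest arrival: decay of correlations -/

section Arrivals

variable {Ω : Type*}

/-- The information contained in the variables `X s` for `s < t`. -/
abbrev past (X : ℕ → Ω → Bool) (t : ℕ) : MeasurableSpace Ω :=
  ⨆ s ∈ Set.Iio t, MeasurableSpace.comap (X s) inferInstance

lemma past_mono (X : ℕ → Ω → Bool) {s t : ℕ} (h : s ≤ t) : past X s ≤ past X t :=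
  biSup_mono fun _ hi => lt_of_lt_of_le hi h

lemma measurable_past_latestAge (X : ℕ → Ω → Bool) (a0 t : ℕ) :
    Measurable[past X t] fun ω => latestAge a0 (fun s => X s ω) t := by
  induction t with
  | zero => exact measurable_const
  | succ t ih =>
    have hX : Measurable[past X (t + 1)] (X t) :=
      Measurable.of_comap_le (le_iSup₂_of_le t (Set.mem_Iio.2 (Nat.lt_succ_self t)) le_rfl)
    have ih' : Measurable[past X (t + 1)] fun ω => latestAge a0 (fun s => X s ω) t :=
      ih.mono (past_mono X (Nat.le_succ t)) le_rfl
    exact Measurable.ite (hX (measurableSet_singleton true)) measurable_const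
      (ih'.add measurable_const)

/-- Deviation of the age of the last arrival from its stationary mean. -/
noncomputable def dev (p : ℝ) (a0 : ℕ) (x : ℕ → Bool) (t : ℕ) : ℝ :=
  latestAge a0 x t - (1 - p) / p

lemma measurable_past_dev (X : ℕ → Ω → Bool) (p : ℝ) (a0 t : ℕ) :
    Measurable[past X t] fun ω => dev p a0 (fun s => X s ω) t :=
  (measurable_from_top.comp (measurable_past_latestAge X a0 t)).sub measurable_const

variable [MeasurableSpace Ω] {μ : Measure Ω}

lemma past_le {X : ℕ → Ω → Bool} (hX : ∀ t, Measurable (X t)) (t : ℕ) :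
    past X t ≤ ‹MeasurableSpace Ω› :=
  iSup₂_le fun s _ => (hX s).comap_le

/-- Independent Bernoulli variables with parameter `p`. -/
structure IsBernoulliSeq (μ : Measure Ω) (p : ℝ) (X : ℕ → Ω → Bool) : Prop where
  measurable : ∀ t, Measurable (X t)
  law : ∀ t, μ {ω | X t ω = true} = ENNReal.ofReal p
  indep : iIndepFun X μ

lemma IsBernoulliArrivals.isBernoulliSeq {N : ℕ} {lam : Fin N → ℝ} {L : Fin N → ℕ → Ω → Bool}
    (hL : IsBernoulliArrivals μ lam L) (n : Fin N) : IsBernoulliSeq μ (lam n) (L n) where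
  measurable := hL.measurable n
  law := hL.law n
  indep := hL.indep.precomp (g := fun t : ℕ => (n, t)) fun a b h => by simpa using h

variable {X : ℕ → Ω → Bool} {p : ℝ}

namespace IsBernoulliSeq

lemma measurable_dev (hX : IsBernoulliSeq μ p X) (a0 t : ℕ) :
    Measurable fun ω => dev p a0 (fun s => X s ω) t :=
  (measurable_past_dev X p a0 t).mono (past_le hX.measurable t) le_rfl

variable [IsProbabilityMeasure μ]

lemma integral_ite (hX : IsBernoulliSeq μ p X) (hp : 0 < p) (t : ℕ) :
    ∫ ω, (if X t ω = true then (0 : ℝ) else 1) ∂μ = 1 - p := by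
  have hm : MeasurableSet {ω | X t ω = true} := hX.measurable t (measurableSet_singleton true)
  have e : (fun ω => if X t ω = true then (0 : ℝ) else 1) =
      fun ω => 1 - {ω | X t ω = true}.indicator (fun _ => (1 : ℝ)) ω := by
    funext ω
    by_cases h : X t ω = true <;> simp [h]
  rw [e, integral_sub (integrable_const _) ((integrable_const _).indicator hm),
    integral_indicator_const _ hm, measureReal_def, hX.law t, ENNReal.toReal_ofReal hp.le]
  simp

/-- The arrival in slot `t` is independent of the past, on which `g` depends. -/
lemma integral_ite_mul (hX : IsBernoulliSeq μ p X) (hp : 0 < p) {t : ℕ} {g : Ω → ℝ}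
    (hg : Measurable[past X t] g) :
    ∫ ω, (if X t ω = true then 0 else g ω) ∂μ = (1 - p) * ∫ ω, g ω ∂μ := by
  have h1 : Indep (past X t) (⨆ s ∈ ({t} : Set ℕ), MeasurableSpace.comap (X s) inferInstance) μ :=
    indep_iSup_of_disjoint (fun s => (hX.measurable s).comap_le) hX.indep.iIndep (by simp)
  rw [iSup_singleton] at h1
  have hIm : Measurable fun b : Bool => if b = true then (0 : ℝ) else 1 := measurable_of_countable _
  have h2 : IndepFun (fun ω => if X t ω = true then (0 : ℝ) else 1) g μ := by
    rw [IndepFun_iff_Indep]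
    exact (indep_of_indep_of_le h1 hg.comap_le
      (hIm.comp (comap_measurable (X t))).comap_le).symm
  have hI := hIm.comp (hX.measurable t)
  have h3 := h2.integral_fun_mul_eq_mul_integral hI.aestronglyMeasurable
    (hg.mono (past_le hX.measurable t) le_rfl).aestronglyMeasurable
  rw [hX.integral_ite hp t] at h3
  rw [← h3]
  congr 1
  funext ω
  split <;> simp

lemma memLp_dev (hX : IsBernoulliSeq μ p X) (a0 t : ℕ) :
    MemLp (fun ω => dev p a0 (fun s => X s ω) t) 2 μ := by
  refine MemLp.of_bound (hX.measurable_dev a0 t).aestronglyMeasurable (a0 + t + |(1 - p) / p|)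
    (ae_of_all _ fun ω => (abs_sub _ _).trans ?_)
  have : (latestAge a0 (fun s => X s ω) t : ℝ) ≤ a0 + t := by exact_mod_cast latestAge_le _ _ _
  rw [Nat.abs_cast]
  gcongr

/-- The constant 1/p is the mean (1 - p)/p plus one slot of ageing. In this form the indicator of no
arrival multiplies a quantity determined by the past. -/
lemma dev_succ (hp : p ≠ 0) (a0 : ℕ) (x : ℕ → Bool) (t : ℕ) :
    dev p a0 x (t + 1) = (if x t = true then 0 else dev p a0 x t + 1 / p) - (1 - p) / p := by
  have : 1 / p = (1 - p) / p + 1 := by field_simp; ring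
  rw [this]
  simp only [dev, latestAge]
  split
  · simp
  · push_cast; ring

/-- Given the past, the next deviation has mean (1 - p)(dev + 1/p) - (1 - p)/p = (1 - p) dev. -/
lemma integral_mul_dev_succ (hX : IsBernoulliSeq μ p X) (hp : 0 < p) (a0 : ℕ) {t : ℕ} {f : Ω → ℝ}
    (hf : Measurable[past X t] f) (hf2 : MemLp f 2 μ) :
    ∫ ω, f ω * dev p a0 (fun s => X s ω) (t + 1) ∂μ =
      (1 - p) * ∫ ω, f ω * dev p a0 (fun s => X s ω) t ∂μ := by
  have hfi : Integrable f μ := hf2.integrable one_le_two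
  have hfd : Integrable (fun ω => f ω * dev p a0 (fun s => X s ω) t) μ :=
    hf2.integrable_mul (hX.memLp_dev a0 t)
  have hg : Measurable[past X t] fun ω => f ω * (dev p a0 (fun s => X s ω) t + 1 / p) :=
    hf.mul ((measurable_past_dev X p a0 t).add measurable_const)
  have hgi : Integrable (fun ω => f ω * (dev p a0 (fun s => X s ω) t + 1 / p)) μ := by
    simp_rw [mul_add]
    exact hfd.add (hfi.mul_const _)
  have e : (fun ω => f ω * dev p a0 (fun s => X s ω) (t + 1)) = fun ω =>
      (if X t ω = true then 0 else f ω * (dev p a0 (fun s => X s ω) t + 1 / p)) -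
        f ω * ((1 - p) / p) := by
    funext ω
    rw [dev_succ hp.ne']
    split <;> ring
  have hm : MeasurableSet {ω | X t ω = true} := hX.measurable t (measurableSet_singleton true)
  have hgi' : Integrable (fun ω => if X t ω = true then 0 else
      f ω * (dev p a0 (fun s => X s ω) t + 1 / p)) μ := by
    refine hgi.mono (Measurable.ite hm measurable_const
      (hg.mono (past_le hX.measurable t) le_rfl)).aestronglyMeasurable (ae_of_all _ fun ω => ?_)
    split
    · simpa using mul_nonneg (abs_nonneg _) (abs_nonneg _)
    · exact le_rfl
  rw [e, integral_sub hgi' (hfi.mul_const _), hX.integral_ite_mul hp hg, integral_mul_const]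
  simp_rw [mul_add]
  have hadd : ∫ ω, f ω * dev p a0 (fun s => X s ω) t + f ω * (1 / p) ∂μ =
      ∫ ω, f ω * dev p a0 (fun s => X s ω) t ∂μ + (∫ ω, f ω ∂μ) * (1 / p) := by
    rw [integral_add hfd (hfi.mul_const _), integral_mul_const]
  rw [hadd]
  ring

lemma integral_dev_mul_dev (hX : IsBernoulliSeq μ p X) (hp : 0 < p) (a0 s k : ℕ) :
    ∫ ω, dev p a0 (fun s => X s ω) s * dev p a0 (fun s => X s ω) (s + k) ∂μ =
      (1 - p) ^ k * ∫ ω, dev p a0 (fun s => X s ω) s ^ 2 ∂μ := by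
  induction k with
  | zero => simp [sq]
  | succ k ih =>
    rw [← add_assoc, hX.integral_mul_dev_succ hp a0
      ((measurable_past_dev X p a0 s).mono (past_mono X (Nat.le_add_right s k)) le_rfl)
      (hX.memLp_dev a0 s), ih]
    ring

/-- The second moment E satisfies the contraction E' ≤ (1 - p²) E + K, whose fixed point is K / p².
The other term of the bound is the value at time 0. -/
lemma exists_integral_dev_sq_le (hX : IsBernoulliSeq μ p X) (hp : 0 < p) (hp1 : p ≤ 1) (a0 : ℕ) :
    ∃ V, ∀ t, ∫ ω, dev p a0 (fun s => X s ω) t ^ 2 ∂μ ≤ V := by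
  set m := (1 - p) / p with hm
  have hm0 : 0 ≤ m := div_nonneg (by linarith) hp.le
  set K := 1 / p + (1 / p) ^ 2 + m ^ 2 with hK
  have hK0 : 0 ≤ K := by positivity
  refine ⟨((a0 : ℝ) - m) ^ 2 + K / p ^ 2, fun t => ?_⟩
  induction t with
  | zero =>
    have : 0 ≤ K / p ^ 2 := by positivity
    simp [dev, latestAge, ← hm]; linarith
  | succ t ih =>
    set D := fun ω => dev p a0 (fun s => X s ω) t with hD
    have hDm : Measurable[past X t] D := measurable_past_dev X p a0 t
    have hD2 : MemLp D 2 μ := hX.memLp_dev a0 t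
    have hDi : Integrable D μ := hD2.integrable one_le_two
    set g := fun ω => (D ω + 1 / p) ^ 2 - 2 * m * (D ω + 1 / p) with hg
    have hgm : Measurable[past X t] g :=
      ((hDm.add measurable_const).pow_const 2).sub ((hDm.add measurable_const).const_mul _)
    have hgi : Integrable g μ :=
      (hD2.add (memLp_const _)).integrable_sq.sub ((hDi.add (integrable_const _)).const_mul _)
    have hms : MeasurableSet {ω | X t ω = true} := hX.measurable t (measurableSet_singleton true)
    have hgi' : Integrable (fun ω => if X t ω = true then 0 else g ω) μ := by
      refine hgi.mono (Measurable.ite hms measurable_const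
        (hgm.mono (past_le hX.measurable t) le_rfl)).aestronglyMeasurable (ae_of_all _ fun ω => ?_)
      split <;> simp
    have e : (fun ω => dev p a0 (fun s => X s ω) (t + 1) ^ 2) =
        fun ω => (if X t ω = true then 0 else g ω) + m ^ 2 := by
      funext ω
      rw [dev_succ hp.ne', ← hm]
      simp only [hg, hD]
      split <;> ring
    rw [e, integral_add hgi' (integrable_const _), hX.integral_ite_mul hp hgm]
    have hgle : ∫ ω, g ω ∂μ ≤ ∫ ω, ((1 + p) * D ω ^ 2 + (1 / p + (1 / p) ^ 2)) ∂μ := by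
      refine integral_mono hgi ((hD2.integrable_sq.const_mul _).add (integrable_const _))
        fun ω => ?_
      -- The initial age is arbitrary, so `D` need not be centred. This weighting absorbs the linear
      -- term and leaves the factor (1 - p)(1 + p) < 1.
      have h1 : 2 * D ω ≤ p * D ω ^ 2 + 1 / p := by
        have : 0 ≤ (p * D ω - 1) ^ 2 / p := by positivity
        have e2 : (p * D ω - 1) ^ 2 / p = p * D ω ^ 2 - 2 * D ω + 1 / p := by field_simp; ring
        linarith
      have h2 : 1 / p = m + 1 := by rw [hm]; field_simp; ring
      simp only [hg]
      have h3 : (D ω + 1 / p) ^ 2 - 2 * m * (D ω + 1 / p) =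
          D ω ^ 2 + 2 * D ω + (1 / p) ^ 2 - 2 * m * (1 / p) := by rw [h2]; ring
      rw [h3]
      have : 0 ≤ 2 * m * (1 / p) := by positivity
      nlinarith
    rw [integral_add (hD2.integrable_sq.const_mul _) (integrable_const _),
      integral_const_mul] at hgle
    simp only [integral_const, probReal_univ, smul_eq_mul, one_mul] at hgle ⊢
    set E := ∫ ω, D ω ^ 2 ∂μ with hE
    have hq : 0 ≤ 1 - p := by linarith
    have e3 : p ^ 2 * (K / p ^ 2) = K := by field_simp
    have h5 : (1 - p) * ∫ ω, g ω ∂μ ≤ (1 - p) * ((1 + p) * E + (1 / p + (1 / p) ^ 2)) :=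
      mul_le_mul_of_nonneg_left hgle hq
    have h6 : (1 - p) * (1 / p + (1 / p) ^ 2) ≤ 1 * (1 / p + (1 / p) ^ 2) := by
      gcongr; linarith
    have h7 : (1 - p ^ 2) * E ≤ (1 - p ^ 2) * (((a0 : ℝ) - m) ^ 2 + K / p ^ 2) := by
      gcongr
      nlinarith
    have h8 : 0 ≤ p ^ 2 * ((a0 : ℝ) - m) ^ 2 := by positivity
    nlinarith

/-- Weighted law of large numbers for the age of the last arrival, with weights that are
independent of the arrivals. -/
theorem ae_tendsto_weighted_dev (hX : IsBernoulliSeq μ p X) (hp : 0 < p) (hp1 : p ≤ 1) (a0 j : ℕ)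
    {w : ℕ → Ω → ℝ} (hw : ∀ t, Measurable (w t)) (hw0 : ∀ t ω, 0 ≤ w t ω) (hw1 : ∀ t ω, w t ω ≤ 1)
    (hwj : ∀ t ω, t + 1 < j → w t ω = 0)
    (hind : IndepFun (fun ω t => w t ω) (fun ω t => X t ω) μ) :
    ∀ᵐ ω ∂μ, Tendsto (fun T : ℕ =>
      (∑ t ∈ Finset.range T, w t ω * dev p a0 (fun s => X s ω) (t + 1 - j)) / T) atTop (𝓝 0) := by
  obtain ⟨V, hV⟩ := hX.exists_integral_dev_sq_le hp hp1 a0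
  have hq : 0 ≤ 1 - p := by linarith
  have hV0 : 0 ≤ V := (integral_nonneg fun ω => sq_nonneg _).trans (hV 0)
  refine ae_tendsto_average_zero_of_covariance (V := V) (q := 1 - p) hq (by linarith) (fun t => ?_)
    fun s t hst => ?_
  · refine (hX.memLp_dev a0 (t + 1 - j)).mono
      ((hw t).mul (hX.measurable_dev a0 _)).aestronglyMeasurable (ae_of_all _ fun ω => ?_)
    rw [norm_mul, Real.norm_of_nonneg (hw0 t ω)]
    exact mul_le_of_le_one_left (norm_nonneg _) (hw1 t ω)
  -- Where the subtraction `s + 1 - j` would be truncated, the weight vanishes; otherwise the lag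
  -- between the two times stays k.
  · by_cases hsj : s + 1 < j
    · simp only [hwj s _ hsj, zero_mul, integral_zero]
      positivity
    obtain ⟨k, rfl⟩ := Nat.exists_eq_add_of_le hst
    have ek : s + k + 1 - j = s + 1 - j + k := by omega
    have hww : Measurable fun x : ℕ → ℝ => x s * x (s + k) := by fun_prop
    have hmeas : ∀ t, Measurable fun x : ℕ → Bool => dev p a0 x t := fun t => by
      refine ((measurable_from_top (f := fun a : ℕ => (a : ℝ))).comp ?_).sub measurable_const
      exact (measurable_past_latestAge (fun t (x : ℕ → Bool) => x t) a0 t).mono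
        (past_le (fun t => measurable_pi_apply t) t) le_rfl
    -- By independence the mixed moment is the product of that of the weights, at most 1, and that
    -- of the deviations.
    have hi := hind.comp hww ((hmeas (s + 1 - j)).mul (hmeas (s + 1 - j + k)))
    have h := hi.integral_fun_mul_eq_mul_integral
      ((hw s).mul (hw (s + k))).aestronglyMeasurable
      ((hX.measurable_dev a0 _).mul (hX.measurable_dev a0 _)).aestronglyMeasurable
    simp only [Function.comp_def, Pi.mul_apply] at h
    rw [hX.integral_dev_mul_dev hp] at h
    rw [ek, Nat.add_sub_cancel_left]
    have e : ∀ ω, w s ω * dev p a0 (fun s => X s ω) (s + 1 - j) *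
        (w (s + k) ω * dev p a0 (fun s => X s ω) (s + 1 - j + k)) = w s ω * w (s + k) ω *
        (dev p a0 (fun s => X s ω) (s + 1 - j) * dev p a0 (fun s => X s ω) (s + 1 - j + k)) :=
      fun ω => by ring
    simp_rw [e]
    rw [h]
    have hle1 : ∫ ω, w s ω * w (s + k) ω ∂μ ≤ 1 := by
      calc _ ≤ ∫ _, (1 : ℝ) ∂μ :=
            integral_mono_of_nonneg (ae_of_all _ fun ω => mul_nonneg (hw0 _ _) (hw0 _ _))
              (integrable_const _)
              (ae_of_all _ fun ω => mul_le_one₀ (hw1 _ _) (hw0 _ _) (hw1 _ _))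
        _ = 1 := by simp
    have hb : (1 - p) ^ k * ∫ ω, dev p a0 (fun s => X s ω) (s + 1 - j) ^ 2 ∂μ ≤ V * (1 - p) ^ k := by
      rw [mul_comm]
      exact mul_le_mul_of_nonneg_right (hV _) (by positivity)
    have hb0 : 0 ≤ (1 - p) ^ k * ∫ ω, dev p a0 (fun s => X s ω) (s + 1 - j) ^ 2 ∂μ :=
      mul_nonneg (by positivity) (integral_nonneg fun ω => sq_nonneg _)
    exact (mul_le_of_le_one_left hb0 hle1).trans hb

end IsBernoulliSeq

end Arrivals

/-! ### From intervals back to the schedule -/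

section Reconstruction

variable {Ω : Type*} {N : ℕ}

lemma Policy.sum_interval (π : Policy N Ω) {n : Fin N} {ω : Ω}
    (h : {t | π.sched n t ω = true}.Infinite) (k : ℕ) :
    ∑ i ∈ Finset.range (k + 1), π.interval n i ω = π.schedTime n k ω := by
  induction k with
  | zero => simp [Policy.interval]
  | succ k ih =>
    rw [Finset.sum_range_succ, ih]
    simp only [Policy.interval]
    exact Nat.add_sub_cancel' (Nat.nth_monotone h (Nat.le_succ k))

/-- The scheduling decisions with given scheduling intervals. -/
noncomputable def schedOfIntervals (x : Fin N × ℕ → ℕ) (n : Fin N) (t : ℕ) : Bool :=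
  open Classical in decide (∃ k, ∑ i ∈ Finset.range (k + 1), x (n, i) = t)

/-- The partial sums of the intervals are the scheduling times. This transfers independence of the
arrivals from the intervals to the schedule. -/
lemma Policy.schedOfIntervals_eq (π : Policy N Ω) {ω : Ω}
    (h : ∀ n, {t | π.sched n t ω = true}.Infinite) :
    schedOfIntervals (fun q : Fin N × ℕ => π.interval q.1 q.2 ω) =
      fun n t => π.sched n t ω := by
  funext n t
  rw [Bool.eq_iff_iff]
  simp only [schedOfIntervals, decide_eq_true_eq]
  simp_rw [π.sum_interval (h n)]
  constructor
  · rintro ⟨k, rfl⟩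
    exact Nat.nth_mem_of_infinite (h n) k
  · intro ht
    exact ⟨_, Nat.nth_count (p := fun t => π.sched n t ω = true) ht⟩

variable [MeasurableSpace Ω]

lemma measurable_schedOfIntervals (n : Fin N) (t : ℕ) :
    Measurable fun x : Fin N × ℕ → ℕ => schedOfIntervals x n t := by
  refine measurable_to_bool ?_
  have : (fun x : Fin N × ℕ → ℕ => schedOfIntervals x n t) ⁻¹' {true} =
      ⋃ k : ℕ, {x | ∑ i ∈ Finset.range (k + 1), x (n, i) = t} := by
    ext x
    simp [schedOfIntervals]
  rw [this]
  refine MeasurableSet.iUnion fun k => ?_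
  have hm : Measurable fun x : Fin N × ℕ → ℕ => ∑ i ∈ Finset.range (k + 1), x (n, i) := by fun_prop
  exact hm (measurableSet_singleton t)

lemma measurable_elapsed_solo {u : Fin N → ℕ → Ω → Bool} (hu : ∀ n t, Measurable (u n t))
    (x0 : ℕ) (n : Fin N) (t : ℕ) :
    Measurable fun ω => elapsed x0 (solo (fun m s => u m s ω) n) t := by
  induction t with
  | zero => exact measurable_const
  | succ t ih =>
    have hv : Measurable fun ω (m : Fin N) => u m t ω := measurable_pi_lambda _ fun m => hu m t
    have hs : Measurable fun ω => solo (fun m s => u m s ω) n t :=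
      (measurable_of_countable fun v : Fin N → Bool =>
        decide (v n = true ∧ ∀ m, m ≠ n → v m = false)).comp hv
    exact Measurable.ite (hs (measurableSet_singleton true)) measurable_const
      (ih.add measurable_const)

lemma measurable_indicator_elapsed_solo {u : Fin N → ℕ → Ω → Bool} (hu : ∀ n t, Measurable (u n t))
    (x0 : ℕ) (n : Fin N) (j t : ℕ) : Measurable fun ω =>
      if elapsed x0 (solo (fun m s => u m s ω) n) t = j then (1 : ℝ) else 0 :=
  Measurable.ite (measurable_elapsed_solo hu x0 n t (measurableSet_singleton j))
    measurable_const measurable_const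

lemma Policy.IsAIR.ae_tendsto_dev {μ : Measure Ω} [IsProbabilityMeasure μ] {lam : Fin N → ℝ}
    (hlam : ∀ n, 0 < lam n ∧ lam n ≤ 1) {L : Fin N → ℕ → Ω → Bool}
    (hL : IsBernoulliArrivals μ lam L) {B : ℕ∞} {π : Policy N Ω} (hπ : π.IsAdmissible L B)
    (hair : π.IsAIR μ L) (h0 : Fin N → ℕ) :
    ∀ᵐ ω ∂μ, ∀ (n : Fin N) (j : ℕ), Tendsto (fun T : ℕ => (∑ t ∈ Finset.range T,
      (if elapsed 0 (solo (fun m s => π.sched m s ω) n) (t + 1) = j then (1 : ℝ) else 0) *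
        dev (lam n) (h0 n) (fun s => L n s ω) (t + 1 - j)) / T) atTop (𝓝 0) := by
  rw [ae_all_iff]; intro n
  rw [ae_all_iff]; intro j
  refine (hL.isBernoulliSeq n).ae_tendsto_weighted_dev (hlam n).1 (hlam n).2 (h0 n) j
    (fun t => measurable_indicator_elapsed_solo hπ.measurable_sched 0 n j (t + 1))
    (fun t ω => ?_) (fun t ω => ?_) (fun t ω ht => ?_) ?_
  · positivity
  · split <;> norm_num
  · have := elapsed_zero_le (solo (fun m s => π.sched m s ω) n) (t + 1)
    exact if_neg (by omega)
  · have h1 : Measurable fun (x : Fin N × ℕ → ℕ) (t : ℕ) =>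
        if elapsed 0 (solo (fun m s => schedOfIntervals x m s) n) (t + 1) = j then (1 : ℝ) else 0 :=
      measurable_pi_lambda _ fun t => 
        measurable_indicator_elapsed_solo measurable_schedOfIntervals 0 n j (t + 1)
    have h2 : Measurable fun (y : Fin N × ℕ → Bool) (t : ℕ) => y (n, t) := by fun_prop
    -- The reconstruction is valid only on paths with infinitely many scheduling times, hence almost
    -- surely.
    refine (hair.indep_arrivals.comp h1 h2).congr ?_ (ae_of_all _ fun ω => rfl)
    filter_upwards [ae_all_iff.2 hair.infinite] with ω hω
    simp only [Function.comp_def, π.schedOfIntervals_eq hω]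

end Reconstruction

/-! ### Bounds on the time averages -/

section Averages

variable {Ω : Type*} {N : ℕ}

lemma Policy.avgAoI_eq (h0 : Fin N → ℕ) (π : Policy N Ω) (T : ℕ) (ω : Ω) :
    π.avgAoI h0 T ω =
      1 / (N : ℝ) * ∑ n, (∑ t ∈ Finset.range T, (π.aoi h0 n (t + 1) ω : ℝ)) / T := by
  have : ∑ t ∈ Finset.Icc 1 T, ∑ n : Fin N, (π.aoi h0 n t ω : ℝ) =
      ∑ t ∈ Finset.range T, ∑ n : Fin N, (π.aoi h0 n (t + 1) ω : ℝ) := by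
    rw [Finset.range_eq_Ico, Finset.sum_Ico_add' (fun t => ∑ n : Fin N, (π.aoi h0 n t ω : ℝ)) 0 T 1]
    rfl
  rw [Policy.avgAoI, this, Finset.sum_comm, ← Finset.sum_div]
  ring

lemma sum_indicator_mul (d M : ℕ) (f : ℕ → ℝ) :
    ∑ j ∈ Finset.range M, (if d = j then (1 : ℝ) else 0) * f j = if d < M then f d else 0 := by
  simp

lemma sum_inv_eq [NeZero N] {lam : Fin N → ℝ} (hlam : ∀ n, 0 < lam n ∧ lam n ≤ 1) :
    1 / (N : ℝ) * ∑ n, 1 / lam n + ((N : ℝ) - 1) / 2 =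
      ((N : ℝ) + 1) / 2 + 1 / (N : ℝ) * ∑ n, (1 - lam n) / lam n := by
  have h : ∀ n, (1 - lam n) / lam n = 1 / lam n - 1 := fun n => by
    have := (hlam n).1.ne'
    field_simp
  have hN : (N : ℝ) ≠ 0 := by exact_mod_cast NeZero.ne N
  simp_rw [h]
  rw [Finset.sum_sub_distrib]
  simp
  field_simp
  ring

/-- The per-slot bound holds from time N on; subtracting N from T discards the earlier slots. -/
lemma mul_sub_le_sum_elapsed {s : Fin N → ℕ → Bool}
    (hs : ∀ t n m, s n t = true → s m t = true → n = m) (T : ℕ) :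
    ((T : ℝ) - N) * (N * (N + 1) / 2) ≤
      ∑ n, ∑ t ∈ Finset.range T, (elapsed 0 (s n) (t + 1) : ℝ) := by
  rw [Finset.sum_comm]
  induction T with
  | zero =>
    have : (0 : ℝ) ≤ N * (N * (N + 1) / 2) := by positivity
    simp; linarith
  | succ T ih =>
    rw [Finset.sum_range_succ]
    by_cases h : N ≤ T + 1
    · have := le_sum_elapsed hs h
      push_cast; linarith
    · have h' : ((T + 1 : ℕ) : ℝ) - N ≤ 0 := by
        rw [sub_nonpos]; exact_mod_cast (not_le.1 h).le
      have h1 : 0 ≤ ∑ n, (elapsed 0 (s n) (T + 1) : ℝ) := by positivity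
      have h2 : 0 ≤ ∑ t ∈ Finset.range T, ∑ n, (elapsed 0 (s n) (t + 1) : ℝ) := by positivity
      have h3 : (((T + 1 : ℕ) : ℝ) - N) * (N * (N + 1) / 2) ≤ 0 :=
        mul_nonpos_of_nonpos_of_nonneg h' (by positivity)
      linarith

/-- Pathwise lower bound for the time-average AoI. -/
lemma eventually_lt_avgAoI [MeasurableSpace Ω] [NeZero N] {lam : Fin N → ℝ}
    (hlam : ∀ n, 0 < lam n ∧ lam n ≤ 1) {L : Fin N → ℕ → Ω → Bool} {B : ℕ∞} {π : Policy N Ω}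
    (hπ : π.IsAdmissible L B) (h0 : Fin N → ℕ) {ω : Ω}
    (hω : ∀ (n : Fin N) (j : ℕ), Tendsto (fun T : ℕ => (∑ t ∈ Finset.range T,
      (if elapsed 0 (solo (fun m s => π.sched m s ω) n) (t + 1) = j then (1 : ℝ) else 0) *
        dev (lam n) (h0 n) (fun s => L n s ω) (t + 1 - j)) / T) atTop (𝓝 0))
    {b : ℝ} (hb : b < 1 / (N : ℝ) * ∑ n, 1 / lam n + ((N : ℝ) - 1) / 2) :
    ∀ᶠ T in atTop, b < π.avgAoI h0 T ω := by
  rw [sum_inv_eq hlam] at hb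
  set m : Fin N → ℝ := fun n => (1 - lam n) / lam n with hm
  have hm0 : ∀ n, 0 ≤ m n := fun n => div_nonneg (by linarith [(hlam n).2]) (hlam n).1.le
  set S := ∑ n, m n with hS
  have hS0 : 0 ≤ S := Finset.sum_nonneg fun n _ => hm0 n
  have hmS : ∀ n, m n ≤ S := fun n => Finset.single_le_sum (fun n _ => hm0 n) (Finset.mem_univ n)
  have hN : (0 : ℝ) < N := by exact_mod_cast NeZero.pos N
  -- The law of large numbers holds for each fixed j, so elapsed times are truncated at a level M.
  -- The loss, a fraction S / M of the elapsed time, tends to 0 as M grows.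
  obtain ⟨M, hMS, hM0, hbM⟩ : ∃ M : ℕ, S ≤ M ∧ 0 < M ∧
      b < (1 - S / M) * (((N : ℝ) + 1) / 2) + 1 / (N : ℝ) * S := by
    have h1 : Tendsto (fun M : ℕ => (1 - S / (M : ℝ)) * (((N : ℝ) + 1) / 2) + 1 / (N : ℝ) * S) atTop
        (𝓝 ((1 - 0) * (((N : ℝ) + 1) / 2) + 1 / (N : ℝ) * S)) :=
      (((tendsto_const_nhds.div_atTop tendsto_natCast_atTop_atTop).const_sub 1).mul_const
        _).add_const _
    rw [sub_zero, one_mul] at h1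
    exact ((tendsto_natCast_atTop_atTop.eventually_ge_atTop S).and
      ((eventually_gt_atTop 0).and (h1.eventually_const_lt hb))).exists
  have hM : (0 : ℝ) < M := by exact_mod_cast hM0
  set d : Fin N → ℕ → ℕ := fun n t => elapsed 0 (solo (fun m s => π.sched m s ω) n) t with hd
  set E : Fin N → ℕ → ℕ → ℝ := fun n j T => (∑ t ∈ Finset.range T,
      (if d n (t + 1) = j then (1 : ℝ) else 0) *
        dev (lam n) (h0 n) (fun s => L n s ω) (t + 1 - j)) / T with hE
  have hlow : ∀ᶠ T : ℕ in atTop, (1 - S / M) * (((N : ℝ) + 1) / 2) * (1 - N / T) +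
      1 / (N : ℝ) * S + 1 / (N : ℝ) * ∑ n, ∑ j ∈ Finset.range M, E n j T ≤ π.avgAoI h0 T ω := by
    filter_upwards [eventually_gt_atTop 0] with T hT
    have hT' : (0 : ℝ) < T := by exact_mod_cast hT
    have hSM : 0 ≤ 1 - S / M := by rw [sub_nonneg]; exact div_le_one_of_le₀ hMS hM.le
    -- Below M the age is exactly its mean plus the deviation. From M on the age is dropped, and the
    -- mean is paid for by m n ≤ S ≤ (S / M) d.
    have hpt : ∀ n t, (1 - S / M) * (d n (t + 1) : ℝ) + m n + ∑ j ∈ Finset.range M,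
        (if d n (t + 1) = j then (1 : ℝ) else 0) *
          dev (lam n) (h0 n) (fun s => L n s ω) (t + 1 - j) ≤ π.aoi h0 n (t + 1) ω := fun n t => by
      have h1 : ((d n (t + 1) + latestAge (h0 n) (fun t => L n t ω) (t + 1 - d n (t + 1)) : ℕ) : ℝ) ≤
          π.aoi h0 n (t + 1) ω := by exact_mod_cast hπ.le_aoi h0 n (t + 1) ω
      refine le_trans ?_ h1
      rw [sum_indicator_mul _ _ fun j => dev (lam n) (h0 n) (fun s => L n s ω) (t + 1 - j)]
      push_cast
      have h2 : 0 ≤ S / M * (d n (t + 1) : ℝ) := by positivity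
      split
      · simp only [dev, hm]; linarith
      · rename_i hlt
        have h3 : (M : ℝ) ≤ d n (t + 1) := by exact_mod_cast not_lt.1 hlt
        have h4 : S ≤ S / M * (d n (t + 1) : ℝ) := by
          rw [div_mul_eq_mul_div, le_div_iff₀ hM]
          gcongr
        have h5 : (0 : ℝ) ≤ latestAge (h0 n) (fun t => L n t ω) (t + 1 - d n (t + 1)) := by
          positivity
        linarith [hmS n]
    have hsum : ∀ n, (1 - S / M) * ((∑ t ∈ Finset.range T, (d n (t + 1) : ℝ)) / T) + m n +
        ∑ j ∈ Finset.range M, E n j T ≤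
        (∑ t ∈ Finset.range T, (π.aoi h0 n (t + 1) ω : ℝ)) / T := fun n => by
      rw [le_div_iff₀ hT']
      refine le_trans (le_of_eq ?_) (Finset.sum_le_sum fun t _ => hpt n t)
      rw [Finset.sum_add_distrib, Finset.sum_add_distrib, Finset.sum_comm, ← Finset.mul_sum,
        Finset.sum_const, Finset.card_range, nsmul_eq_mul, ← Finset.sum_div, add_mul, add_mul,
        mul_assoc, div_mul_cancel₀ _ hT'.ne', div_mul_cancel₀ _ hT'.ne']
      ring
    have hD := mul_sub_le_sum_elapsed (s := solo fun m s => π.sched m s ω)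
      (fun t n m h1 h2 => solo_unique h1 h2) T
    rw [π.avgAoI_eq]
    have hD' : ((N : ℝ) + 1) / 2 * (1 - N / T) ≤
        1 / (N : ℝ) * ∑ n, (∑ t ∈ Finset.range T, (d n (t + 1) : ℝ)) / T := by
      rw [← Finset.sum_div]
      calc _ = 1 / (N : ℝ) * ((((T : ℝ) - N) * (N * (N + 1) / 2)) / T) := by field_simp
        _ ≤ _ := by gcongr
    calc _ = (1 - S / M) * (((N : ℝ) + 1) / 2 * (1 - N / T)) +
          1 / (N : ℝ) * S + 1 / (N : ℝ) * ∑ n, ∑ j ∈ Finset.range M, E n j T := by ring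
      _ ≤ (1 - S / M) * (1 / (N : ℝ) * ∑ n, (∑ t ∈ Finset.range T, (d n (t + 1) : ℝ)) / T) +
          1 / (N : ℝ) * S + 1 / (N : ℝ) * ∑ n, ∑ j ∈ Finset.range M, E n j T := by gcongr
      _ = 1 / (N : ℝ) * ∑ n, ((1 - S / M) * ((∑ t ∈ Finset.range T, (d n (t + 1) : ℝ)) / T) + m n +
          ∑ j ∈ Finset.range M, E n j T) := by
          rw [Finset.sum_add_distrib, Finset.sum_add_distrib, ← Finset.mul_sum, ← hS]; ring
      _ ≤ _ := by
          gcongr with n _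
          exact hsum n
  have hlim : Tendsto (fun T : ℕ => (1 - S / M) * (((N : ℝ) + 1) / 2) * (1 - N / T) +
      1 / (N : ℝ) * S + 1 / (N : ℝ) * ∑ n, ∑ j ∈ Finset.range M, E n j T) atTop
      (𝓝 ((1 - S / M) * (((N : ℝ) + 1) / 2) * (1 - 0) +
        1 / (N : ℝ) * S + 1 / (N : ℝ) * ∑ n : Fin N, ∑ j ∈ Finset.range M, (0 : ℝ))) :=
    ((((tendsto_const_nhds.div_atTop tendsto_natCast_atTop_atTop).const_sub 1).const_mul
      _).add_const _).add
      ((tendsto_finsetSum _ fun n _ => tendsto_finsetSum _ fun j _ => hω n j).const_mul _)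
  simp only [sub_zero, mul_one, Finset.sum_const_zero, mul_zero, add_zero] at hlim
  filter_upwards [hlow, hlim.eventually_const_lt hbM] with T h1 h2
  exact h2.trans_le h1

/-- Pathwise upper bound for the time-average AoI. -/
lemma eventually_avgAoI_lt [NeZero N] {lam : Fin N → ℝ}
    (hlam : ∀ n, 0 < lam n ∧ lam n ≤ 1) {L : Fin N → ℕ → Ω → Bool} {π : Policy N Ω}
    (h0 : Fin N → ℕ) {ω : Ω} {d : Fin N → ℕ → ℕ}
    (hπ : ∀ n t, π.aoi h0 n t ω ≤ d n t + latestAge (h0 n) (fun t => L n t ω) (t - d n t))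
    (hdN : ∀ n t, d n t ≤ N) (hdsum : ∀ t, N ≤ t → ∑ n, (d n t : ℝ) ≤ N * (N + 1) / 2)
    (hω : ∀ (n : Fin N) (j : ℕ), Tendsto (fun T : ℕ => (∑ t ∈ Finset.range T,
      (if d n (t + 1) = j then (1 : ℝ) else 0) *
        dev (lam n) (h0 n) (fun s => L n s ω) (t + 1 - j)) / T) atTop (𝓝 0))
    {b : ℝ} (hb : 1 / (N : ℝ) * ∑ n, 1 / lam n + ((N : ℝ) - 1) / 2 < b) :
    ∀ᶠ T in atTop, π.avgAoI h0 T ω < b := by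
  rw [sum_inv_eq hlam] at hb
  set m : Fin N → ℝ := fun n => (1 - lam n) / lam n with hm
  have hN : (0 : ℝ) < N := by exact_mod_cast NeZero.pos N
  set E : Fin N → ℕ → ℕ → ℝ := fun n j T => (∑ t ∈ Finset.range T,
      (if d n (t + 1) = j then (1 : ℝ) else 0) *
        dev (lam n) (h0 n) (fun s => L n s ω) (t + 1 - j)) / T with hE
  -- The last term covers the first N slots, where only d ≤ N is available.
  have hD : ∀ T : ℕ, ∑ n, ∑ t ∈ Finset.range T, (d n (t + 1) : ℝ) ≤
      T * (N * (N + 1) / 2) + N * (N * N) := fun T => by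
    have hone : ∀ t, ∑ n, (d n t : ℝ) ≤ N * N := fun t => by
      calc ∑ n, (d n t : ℝ) ≤ ∑ n : Fin N, (N : ℝ) :=
            Finset.sum_le_sum fun n _ => by exact_mod_cast hdN n t
        _ = N * N := by simp
    rw [Finset.sum_comm]
    rcases le_total T N with hTN | hTN
    · calc _ ≤ ∑ t ∈ Finset.range T, (N * N : ℝ) := Finset.sum_le_sum fun t _ => hone _
        _ = T * (N * N) := by simp
        _ ≤ N * (N * N) := by gcongr
        _ ≤ _ := le_add_of_nonneg_left (by positivity)
    · rw [← Finset.sum_range_add_sum_Ico _ hTN, add_comm]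
      gcongr
      · calc _ ≤ ∑ t ∈ Finset.Ico N T, (N * (N + 1) / 2 : ℝ) := Finset.sum_le_sum fun t ht =>
              hdsum _ ((Finset.mem_Ico.1 ht).1.trans (Nat.le_succ t))
          _ = (T - N : ℕ) * (N * (N + 1) / 2) := by simp
          _ ≤ _ := by gcongr; exact Nat.sub_le _ _
      · calc _ ≤ ∑ t ∈ Finset.range N, (N * N : ℝ) := Finset.sum_le_sum fun t _ => hone _
          _ = N * (N * N) := by simp
  have hup : ∀ᶠ T : ℕ in atTop, π.avgAoI h0 T ω ≤ ((N : ℝ) + 1) / 2 + N * N / T +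
      1 / (N : ℝ) * ∑ n, m n + 1 / (N : ℝ) * ∑ n, ∑ j ∈ Finset.range (N + 1), E n j T := by
    filter_upwards [eventually_gt_atTop 0] with T hT
    have hT' : (0 : ℝ) < T := by exact_mod_cast hT
    have hpt : ∀ n t, (π.aoi h0 n (t + 1) ω : ℝ) ≤ d n (t + 1) + m n +
        ∑ j ∈ Finset.range (N + 1), (if d n (t + 1) = j then (1 : ℝ) else 0) *
          dev (lam n) (h0 n) (fun s => L n s ω) (t + 1 - j) := fun n t => by
      have h1 : (π.aoi h0 n (t + 1) ω : ℝ) ≤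
          (d n (t + 1) + latestAge (h0 n) (fun t => L n t ω) (t + 1 - d n (t + 1)) : ℕ) := by
        exact_mod_cast hπ n (t + 1)
      refine h1.trans (le_of_eq ?_)
      rw [sum_indicator_mul _ _ fun j => dev (lam n) (h0 n) (fun s => L n s ω) (t + 1 - j),
        if_pos (Nat.lt_succ_of_le (hdN n _))]
      push_cast
      simp only [dev, hm]; ring
    have hsum : ∀ n, (∑ t ∈ Finset.range T, (π.aoi h0 n (t + 1) ω : ℝ)) / T ≤
        (∑ t ∈ Finset.range T, (d n (t + 1) : ℝ)) / T + m n +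
        ∑ j ∈ Finset.range (N + 1), E n j T := fun n => by
      rw [div_le_iff₀ hT']
      refine (Finset.sum_le_sum fun t _ => hpt n t).trans (le_of_eq ?_)
      rw [Finset.sum_add_distrib, Finset.sum_add_distrib, Finset.sum_comm, Finset.sum_const,
        Finset.card_range, nsmul_eq_mul, ← Finset.sum_div, add_mul, add_mul,
        div_mul_cancel₀ _ hT'.ne', div_mul_cancel₀ _ hT'.ne']
      ring
    rw [π.avgAoI_eq]
    calc _ ≤ 1 / (N : ℝ) * ∑ n, ((∑ t ∈ Finset.range T, (d n (t + 1) : ℝ)) / T + m n +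
          ∑ j ∈ Finset.range (N + 1), E n j T) := by
          gcongr with n _
          exact hsum n
      _ = 1 / (N : ℝ) * ((∑ n, ∑ t ∈ Finset.range T, (d n (t + 1) : ℝ)) / T) +
          1 / (N : ℝ) * ∑ n, m n + 1 / (N : ℝ) * ∑ n, ∑ j ∈ Finset.range (N + 1), E n j T := by
          rw [Finset.sum_add_distrib, Finset.sum_add_distrib, ← Finset.sum_div]; ring
      _ ≤ 1 / (N : ℝ) * ((T * (N * (N + 1) / 2) + N * (N * N)) / T) +
          1 / (N : ℝ) * ∑ n, m n + 1 / (N : ℝ) * ∑ n, ∑ j ∈ Finset.range (N + 1), E n j T := by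
          gcongr
          exact hD T
      _ = _ := by
          have : 1 / (N : ℝ) * ((T * (N * (N + 1) / 2) + N * (N * N)) / T) =
            ((N : ℝ) + 1) / 2 + N * N / T := by field_simp
          rw [this]
  have hlim : Tendsto (fun T : ℕ => ((N : ℝ) + 1) / 2 + (N * N : ℝ) / T +
      1 / (N : ℝ) * ∑ n, m n + 1 / (N : ℝ) * ∑ n, ∑ j ∈ Finset.range (N + 1), E n j T) atTop
      (𝓝 (((N : ℝ) + 1) / 2 + 0 + 1 / (N : ℝ) * ∑ n, m n +
        1 / (N : ℝ) * ∑ n : Fin N, ∑ j ∈ Finset.range (N + 1), (0 : ℝ))) :=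
    (((tendsto_const_nhds.div_atTop tendsto_natCast_atTop_atTop).const_add _).add_const _).add
      ((tendsto_finsetSum _ fun n _ => tendsto_finsetSum _ fun j _ => hω n j).const_mul _)
  simp only [Finset.sum_const_zero, mul_zero, add_zero] at hlim
  filter_upwards [hup, hlim.eventually_lt_const hb] with T h1 h2
  exact h1.trans_lt h2

end Averages

/-! ### Round robin: periodicity and optimal ages -/

section RoundRobin

variable {N : ℕ} [NeZero N] {τ0 : Fin N → ℕ}

/-- The schedule of RR-ONE. -/
def rrSched (τ0 : Fin N → ℕ) (n : Fin N) (t : ℕ) : Bool :=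
  decide (n = rrIndex (rrTau τ0 t))

lemma rrSched_unique (τ0 : Fin N → ℕ) (t : ℕ) (n m : Fin N) (hn : rrSched τ0 n t = true)
    (hm : rrSched τ0 m t = true) : n = m := by
  simp only [rrSched, decide_eq_true_eq] at hn hm
  rw [hn, hm]

lemma solo_rrSched (τ0 : Fin N → ℕ) (n : Fin N) : solo (rrSched τ0) n = rrSched τ0 n := by
  funext t
  rw [Bool.eq_iff_iff, solo, decide_eq_true_eq]
  refine ⟨fun h => h.1, fun h => ⟨h, fun m hm => ?_⟩⟩
  rw [← Bool.not_eq_true]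
  exact fun h' => hm (rrSched_unique τ0 t m n h' h)

lemma rrTau_succ (τ0 : Fin N → ℕ) (t : ℕ) (n : Fin N) : rrTau τ0 (t + 1) n =
    if n = rrIndex (rrTau τ0 t) then 1 else rrTau τ0 t n + 1 := rfl

lemma rrTau_eq_elapsed (τ0 : Fin N → ℕ) (n : Fin N) (t : ℕ) :
    rrTau τ0 t n = elapsed (τ0 n) (rrSched τ0 n) t := by
  induction t with
  | zero => rfl
  | succ t ih => simp [rrTau, elapsed, rrSched, ih]

lemma le_rrIndex (τ : Fin N → ℕ) (n : Fin N) : τ n ≤ τ (rrIndex τ) := by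
  have h := Finset.min'_mem _ (exists_eq_sup τ)
  rw [Finset.mem_filter] at h
  rw [rrIndex, h.2]
  exact Finset.le_sup (Finset.mem_univ n)

/-- Values above j + 1 come from values above j, and the scheduled terminal, which has the maximum,
leaves that set. So each slot removes one terminal while the level rises by one. -/
lemma card_lt_rrTau (τ0 : Fin N → ℕ) (t j : ℕ) (hjt : j ≤ t) (hjN : j ≤ N) :
    (Finset.univ.filter fun n => j < rrTau τ0 t n).card ≤ N - j := by
  induction t generalizing j with
  | zero =>
    refine (Finset.card_filter_le _ _).trans ?_
    simp; omega
  | succ t ih =>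
    rcases Nat.eq_zero_or_pos j with rfl | hj0
    · refine (Finset.card_filter_le _ _).trans ?_
      simp
    obtain ⟨j, rfl⟩ : ∃ i, j = i + 1 := ⟨j - 1, by omega⟩
    have h1 := ih j (by omega) (by omega)
    rcases Finset.eq_empty_or_nonempty (Finset.univ.filter fun n => j + 1 < rrTau τ0 (t + 1) n)
      with h | ⟨n, hn⟩
    · rw [h]; simp
    have hsub : (Finset.univ.filter fun n => j + 1 < rrTau τ0 (t + 1) n) ⊆
        (Finset.univ.filter fun n => j < rrTau τ0 t n).erase (rrIndex (rrTau τ0 t)) := by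
      intro n
      rw [Finset.mem_filter_univ, Finset.mem_erase, Finset.mem_filter_univ, rrTau_succ]
      split
      · omega
      · rename_i h
        exact fun h' => ⟨h, by omega⟩
    have hmem : rrIndex (rrTau τ0 t) ∈ Finset.univ.filter fun n => j < rrTau τ0 t n := by
      have := (Finset.mem_erase.1 (hsub hn)).2
      rw [Finset.mem_filter_univ] at this ⊢
      exact this.trans_le (le_rrIndex _ n)
    have h2 := Finset.card_le_card hsub
    rw [Finset.card_erase_of_mem hmem] at h2
    omega

lemma rrTau_le (τ0 : Fin N → ℕ) {t : ℕ} (ht : N ≤ t) (n : Fin N) : rrTau τ0 t n ≤ N := by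
  have h := card_lt_rrTau τ0 t N ht le_rfl
  rw [Nat.sub_self, Nat.le_zero, Finset.card_eq_zero, Finset.filter_eq_empty_iff] at h
  exact not_lt.1 (h (Finset.mem_univ n))

lemma sum_rrTau_le (τ0 : Fin N → ℕ) {t : ℕ} (ht : N ≤ t) :
    ∑ n, (rrTau τ0 t n : ℝ) ≤ N * (N + 1) / 2 := by
  rw [← sum_range_sub_real]
  norm_cast
  rw [← sum_range_card_lt _ N fun n => rrTau_le τ0 ht n]
  refine Finset.sum_le_sum fun j hj => ?_
  have := Finset.mem_range.1 hj
  exact card_lt_rrTau τ0 t j (by omega) (by omega)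

/-- At most j < N terminals have value ≤ j, so the maximum exceeds j. Initial values ≥ 1 make the
count valid up to j = t. -/
lemma lt_rrTau_rrIndex (hτ0 : ∀ n, 1 ≤ τ0 n) {t j : ℕ} (hjt : j ≤ t) (hjN : j < N) :
    j < rrTau τ0 t (rrIndex (rrTau τ0 t)) := by
  have h := card_elapsed_le (rrSched_unique τ0) hτ0 t j (by omega)
  simp_rw [← rrTau_eq_elapsed] at h
  by_contra! hcon
  have h2 : (Finset.univ.filter fun n => rrTau τ0 t n ≤ j) = Finset.univ :=
    Finset.filter_true_of_mem fun n _ => (le_rrIndex _ n).trans hcon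
  rw [h2] at h
  simp at h
  omega

/-- As long as its value is i + 1 < N, the terminal is strictly below the maximum and is not
scheduled again. -/
lemma rrTau_add (hτ0 : ∀ n, 1 ≤ τ0 n) {n : Fin N} {t : ℕ} (hn : rrSched τ0 n t = true) {i : ℕ}
    (hi : i < N) : rrTau τ0 (t + (i + 1)) n = i + 1 := by
  induction i with
  | zero =>
    simp only [rrSched, decide_eq_true_eq] at hn
    rw [zero_add, rrTau_succ, if_pos hn]
  | succ i ih =>
    have h := ih (by omega)
    rw [← add_assoc, rrTau_succ, if_neg, h]
    intro hcon
    have h2 := lt_rrTau_rrIndex hτ0 (t := t + (i + 1)) (j := i + 1) (by omega) hi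
    rw [← hcon, h] at h2
    omega

lemma not_rrSched_add (hτ0 : ∀ n, 1 ≤ τ0 n) {n : Fin N} {t : ℕ} (hn : rrSched τ0 n t = true)
    {i : ℕ} (hi0 : 0 < i) (hi : i < N) : rrSched τ0 n (t + i) = false := by
  obtain ⟨i, rfl⟩ := Nat.exists_eq_add_of_le' hi0
  have h := rrTau_add hτ0 hn (i := i) (by omega)
  have h2 := lt_rrTau_rrIndex hτ0 (t := t + (i + 1)) (j := i + 1) (by omega) hi
  rw [rrSched, decide_eq_false_iff_not]
  intro hcon
  rw [← hcon, h] at h2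
  omega

/-- After N slots the terminal has value N. At most one terminal exceeds N - 1, and the scheduled
one does, so the two coincide. -/
lemma rrSched_add (hτ0 : ∀ n, 1 ≤ τ0 n) {n : Fin N} {t : ℕ} (hn : rrSched τ0 n t = true) :
    rrSched τ0 n (t + N) = true := by
  have hN := NeZero.pos N
  have h := rrTau_add hτ0 hn (i := N - 1) (by omega)
  rw [Nat.sub_add_cancel hN] at h
  have h1 := card_lt_rrTau τ0 (t + N) (N - 1) (by omega) (by omega)
  rw [Nat.sub_sub_self hN, Finset.card_le_one] at h1
  rw [rrSched, decide_eq_true_eq]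
  refine h1 n ?_ _ ?_ <;> rw [Finset.mem_filter_univ]
  · omega
  · exact lt_rrTau_rrIndex hτ0 (by omega) (by omega)

lemma exists_rrSched (hτ0 : ∀ n, 1 ≤ τ0 n) (n : Fin N) : ∃ t, rrSched τ0 n t = true := by
  by_contra! hcon
  have h : ∀ t, rrTau τ0 t n = τ0 n + t := fun t => by
    induction t with
    | zero => rfl
    | succ t ih =>
      rw [rrTau_succ, if_neg (by simpa [rrSched] using hcon t), ih, add_assoc]
  have h1 := rrTau_le τ0 (le_refl N) n
  have h2 := hτ0 n
  rw [h] at h1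
  omega

lemma infinite_rrSched (hτ0 : ∀ n, 1 ≤ τ0 n) (n : Fin N) :
    {t | rrSched τ0 n t = true}.Infinite := by
  obtain ⟨t, ht⟩ := exists_rrSched hτ0 n
  have hN := NeZero.pos N
  have h : ∀ k, rrSched τ0 n (t + k * N) = true := fun k => by
    induction k with
    | zero => simpa using ht
    | succ k ih => rw [Nat.succ_mul, ← add_assoc]; exact rrSched_add hτ0 ih
  refine Set.infinite_of_not_bddAbove fun ⟨b, hb⟩ => ?_
  have h1 := hb (h (b + 1))
  have : (b + 1) * 1 ≤ (b + 1) * N := Nat.mul_le_mul_left _ hN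
  omega

lemma nth_rrSched_succ (hτ0 : ∀ n, 1 ≤ τ0 n) (n : Fin N) (k : ℕ) :
    Nat.nth (fun t => rrSched τ0 n t = true) (k + 1) =
      Nat.nth (fun t => rrSched τ0 n t = true) k + N := by
  have hinf := infinite_rrSched hτ0 n
  have hk := Nat.nth_mem_of_infinite hinf k
  have hk1 := Nat.nth_mem_of_infinite hinf (k + 1)
  have hlt := Nat.nth_strictMono hinf (Nat.lt_succ_self k)
  have hN := NeZero.pos N
  set a := Nat.nth (fun t => rrSched τ0 n t = true) k
  set b := Nat.nth (fun t => rrSched τ0 n t = true) (k + 1)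
  refine le_antisymm ?_ ?_
  · have h := Nat.nth_count (p := fun t => rrSched τ0 n t = true) (rrSched_add hτ0 hk)
    rw [← h]
    refine Nat.nth_monotone hinf ?_
    by_contra! hcon
    have := Nat.nth_monotone hinf (Nat.le_of_lt_succ hcon)
    rw [h] at this
    have h' : a + N ≤ a := this
    omega
  · by_contra! hcon
    have := not_rrSched_add hτ0 hk (i := b - a) (by omega) (by omega)
    rw [Nat.add_sub_cancel' hlt.le, hk1] at this
    exact absurd this (by simp)

variable {Ω : Type*} {L : Fin N → ℕ → Ω → Bool}

lemma rrOne_sched (L : Fin N → ℕ → Ω → Bool) (τ0 : Fin N → ℕ) (n : Fin N) (t : ℕ) (ω : Ω) :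
    (rrOne L τ0).sched n t ω = rrSched τ0 n t := rfl

lemma rrOne_success (L : Fin N → ℕ → Ω → Bool) (τ0 : Fin N → ℕ) (n : Fin N) (t : ℕ) (ω : Ω) :
    (rrOne L τ0).success n t ω = (rrSched τ0 n t).toNat := by
  rw [Policy.success_eq, ← congrFun (solo_rrSched τ0 n) t]
  rfl

/-- Invariant: an empty buffer means no arrival since the last scheduling, so the latest age has
merely grown; a full one holds the freshest packet. -/
lemma rrBuffer_spec (a0 : ℕ) (n : Fin N) (t : ℕ) (ω : Ω) :
    match rrBuffer L τ0 n t ω with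
    | none => latestAge a0 (fun t => L n t ω) t =
        latestAge a0 (fun t => L n t ω) (t - elapsed 0 (rrSched τ0 n) t) +
          elapsed 0 (rrSched τ0 n) t
    | some p => p < t ∧ latestAge a0 (fun t => L n t ω) t = packetAge p t := by
  induction t with
  | zero => simp [rrBuffer, elapsed]
  | succ t ih =>
    have hd := elapsed_zero_le (rrSched τ0 n) t
    rw [rrBuffer]
    by_cases hL : L n t ω = true
    · simp [hL, latestAge, packetAge]
    by_cases hn : n = rrIndex (rrTau τ0 t)
    · have hs : rrSched τ0 n t = true := by simpa [rrSched] using hn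
      rw [if_neg hL, if_pos hn]
      simp [elapsed, hs, latestAge, hL]
    · have hs : rrSched τ0 n t = false := by simpa [rrSched] using hn
      rw [if_neg hL, if_neg hn]
      rcases hb : rrBuffer L τ0 n t ω with _ | p
      · rw [hb] at ih
        simp only [latestAge, elapsed, hs, hL, Bool.false_eq_true, if_false] at ih ⊢
        rw [Nat.add_sub_add_right]
        omega
      · rw [hb] at ih
        simp only [latestAge, hL, packetAge] at ih ⊢
        simp only [Bool.false_eq_true, if_false]
        omega

/-- By the buffer invariant, each scheduling brings the AoI down to the latest age. With an empty
buffer the AoI is there already. -/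
lemma rrOne_aoi_le (h0 : Fin N → ℕ) (n : Fin N) (t : ℕ) (ω : Ω) :
    (rrOne L τ0).aoi h0 n t ω ≤ elapsed 0 (rrSched τ0 n) t +
      latestAge (h0 n) (fun t => L n t ω) (t - elapsed 0 (rrSched τ0 n) t) := by
  induction t with
  | zero => simp [elapsed, latestAge, Policy.aoi]
  | succ t ih =>
    have hspec := rrBuffer_spec (L := L) (τ0 := τ0) (h0 n) n t ω
    rw [Policy.aoi, rrOne_success]
    by_cases hn : n = rrIndex (rrTau τ0 t)
    · have hs : rrSched τ0 n t = true := by simpa [rrSched] using hn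
      have hsent : (rrOne L τ0).sent n t ω = rrBuffer L τ0 n t ω := if_pos hn
      rw [hsent, elapsed, hs]
      rcases hb : rrBuffer L τ0 n t ω with _ | p
      · rw [hb] at hspec
        simp only [gain, Bool.toNat_true, if_true, Nat.add_sub_cancel] at hspec ⊢
        omega
      · rw [hb] at hspec
        simp only [gain, Bool.toNat_true, if_true, Nat.add_sub_cancel, one_mul] at hspec ⊢
        omega
    · have hs : rrSched τ0 n t = false := by simpa [rrSched] using hn
      rw [elapsed, hs]
      simp only [Bool.toNat_false, zero_mul, Nat.sub_zero, Bool.false_eq_true, if_false,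
        Nat.add_sub_add_right]
      omega

variable [MeasurableSpace Ω]

lemma measurableSet_rrBuffer (hL : ∀ n t, Measurable (L n t)) (n : Fin N) (t : ℕ) (o : Option ℕ) :
    MeasurableSet {ω | rrBuffer L τ0 n t ω = o} := by
  induction t generalizing o with
  | zero => exact MeasurableSet.const (none = o)
  | succ t ih =>
    have hm : MeasurableSet {ω | L n t ω = true} := hL n t (measurableSet_singleton true)
    have e : {ω | rrBuffer L τ0 n (t + 1) ω = o} =
        {ω | L n t ω = true}.ite {_ω | some t = o}
          {ω | (if n = rrIndex (rrTau τ0 t) then none else rrBuffer L τ0 n t ω) = o} := by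
      ext ω
      by_cases h : L n t ω = true <;> simp [Set.ite, rrBuffer, h]
    rw [e]
    refine hm.ite (MeasurableSet.const _) ?_
    split
    · exact MeasurableSet.const _
    · exact ih o

lemma rrOne_isAdmissible (hL : ∀ n t, Measurable (L n t)) {B : ℕ∞} (hB : 1 ≤ B)
    (τ0 : Fin N → ℕ) : (rrOne L τ0).IsAdmissible L B where
  measurable_sched n t := measurable_const
  measurable_queue n t s := by
    simpa [rrOne] using measurableSet_rrBuffer (τ0 := τ0) hL n t (some s)
  measurable_sent n t s := by
    simp only [rrOne]
    split
    · exact measurableSet_rrBuffer hL n t (some s)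
    · exact MeasurableSet.const _
  queue_zero n ω := rfl
  queue_succ n t ω s hs := by
    have hs : rrBuffer L τ0 n (t + 1) ω = some s := by simpa [rrOne] using hs
    rw [rrBuffer] at hs
    by_cases hLt : L n t ω = true
    · rw [if_pos hLt, Option.some_inj] at hs
      exact Or.inr ⟨hs.symm, hLt⟩
    · rw [if_neg hLt] at hs
      by_cases hn : n = rrIndex (rrTau τ0 t)
      · simp [if_pos hn] at hs
      · rw [if_neg hn] at hs
        refine Or.inl ⟨by simpa [rrOne] using hs, fun h => ?_⟩
        rw [rrOne_success, rrSched, decide_eq_false hn] at h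
        exact absurd h.1 (by simp)
  queue_card n t ω := by
    refine le_trans ?_ hB
    simp only [rrOne]
    cases rrBuffer L τ0 n t ω <;> simp
  sent_mem n t ω s hs := by
    simp only [rrOne] at hs ⊢
    split at hs
    · rename_i hn
      exact ⟨decide_eq_true hn, by simpa using hs⟩
    · simp at hs

lemma iIndepFun_const {ι β : Type*} [MeasurableSpace β] (μ : Measure Ω) [IsProbabilityMeasure μ]
    (c : ι → β) : iIndepFun (fun i (_ : Ω) => c i) μ := by
  classical
  rw [iIndepFun_iff_measure_inter_preimage_eq_mul]
  intro S sets _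
  by_cases h : ∀ i ∈ S, c i ∈ sets i
  · have h1 : ∀ i ∈ S, (fun _ : Ω => c i) ⁻¹' sets i = Set.univ := fun i hi => by simp [h i hi]
    rw [Finset.prod_congr rfl fun i hi => by rw [h1 i hi], Set.iInter₂_congr h1]
    simp
  · push Not at h
    obtain ⟨i, hi, hci⟩ := h
    have h1 : (fun _ : Ω => c i) ⁻¹' sets i = ∅ := by simp [hci]
    rw [Finset.prod_eq_zero hi (by rw [h1, measure_empty])]
    exact measure_mono_null (Set.biInter_subset_of_mem hi) (by rw [h1, measure_empty])

/-- The schedule is deterministic: the intervals are constants, all equal to N after the initial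
delay. -/
lemma rrOne_isAIR (μ : Measure Ω) [IsProbabilityMeasure μ] (hτ0 : ∀ n, 1 ≤ τ0 n) :
    (rrOne L τ0).IsAIR μ L := by
  have hconst : ∀ n k, ∃ c, (rrOne L τ0).interval n k = fun _ => c := fun n k => by
    rcases isEmpty_or_nonempty Ω with h | ⟨⟨ω⟩⟩
    · exact ⟨0, Subsingleton.elim _ _⟩
    · exact ⟨(rrOne L τ0).interval n k ω, by cases k <;> rfl⟩
  choose c hc using hconst
  have hsucc : ∀ n k, (rrOne L τ0).interval n (k + 1) = fun _ => N := fun n k => by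
    funext ω
    simp only [Policy.interval, Policy.schedTime, rrOne_sched]
    rw [nth_rrSched_succ hτ0, Nat.add_sub_cancel_left]
  refine ⟨fun n => ae_of_all _ fun ω => infinite_rrSched hτ0 n, fun n => ?_, fun n k => ?_,
    fun n => ?_, ?_⟩
  · simp_rw [hc]
    exact iIndepFun_const μ (c n)
  · rw [hsucc n k, hsucc n 0]
    exact IdentDistrib.refl aemeasurable_const
  · rw [hsucc n 0]
    exact ⟨integrable_const _, integrable_const _⟩
  · simp_rw [hc]
    exact indepFun_const_left _ _

end RoundRobin

end AoI

theorem theorem1 {Ω : Type*} [MeasurableSpace Ω] (μ : Measure Ω) [IsProbabilityMeasure μ]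
    (N : ℕ) [NeZero N] (lam : Fin N → ℝ) (hlam : ∀ n, 0 < lam n ∧ lam n ≤ 1)
    (L : Fin N → ℕ → Ω → Bool) (hL : AoI.IsBernoulliArrivals μ lam L)
    (B : ℕ∞) (hB : 1 ≤ B) (h0 : Fin N → ℕ) (τ0 : Fin N → ℕ) (hτ0 : ∀ n, 1 ≤ τ0 n) :
    ((AoI.rrOne L τ0).IsAdmissible L B ∧ (AoI.rrOne L τ0).IsAIR μ L) ∧
    (∀ᵐ ω ∂μ, Tendsto (fun T : ℕ => (AoI.rrOne L τ0).avgAoI h0 T ω) atTop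
      (𝓝 (1 / (N : ℝ) * ∑ n, 1 / lam n + ((N : ℝ) - 1) / 2))) ∧
    (∀ π : AoI.Policy N Ω, π.IsAdmissible L B → π.IsAIR μ L →
      ∀ᵐ ω ∂μ, ((1 / (N : ℝ) * ∑ n, 1 / lam n + ((N : ℝ) - 1) / 2 : ℝ) : EReal) ≤
        liminf (fun T : ℕ => ((π.avgAoI h0 T ω : ℝ) : EReal)) atTop) := by
  have hadm := AoI.rrOne_isAdmissible hL.measurable hB τ0
  have hair : (AoI.rrOne L τ0).IsAIR μ L := AoI.rrOne_isAIR μ hτ0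
  refine ⟨⟨hadm, hair⟩, ?_, fun π hπ hπ' => ?_⟩
  · filter_upwards [hair.ae_tendsto_dev hlam hL hadm h0] with ω hω
    refine tendsto_order.2 ⟨fun b hb => AoI.eventually_lt_avgAoI hlam hadm h0 hω hb,
      fun b hb => AoI.eventually_avgAoI_lt hlam h0 (fun n t => AoI.rrOne_aoi_le h0 n t ω)
        (fun n t => ?_) (fun t ht => ?_) (fun n j => ?_) hb⟩
    -- Before time N the `τ` values may exceed N because of their initial values, but the elapsed
    -- time counted from 0 is at most t.
    · rcases le_total t N with h | h
      · exact (AoI.elapsed_zero_le _ t).trans h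
      · refine (AoI.elapsed_mono (Nat.zero_le (τ0 n)) _ t).trans ?_
        rw [← AoI.rrTau_eq_elapsed]
        exact AoI.rrTau_le τ0 h n
    · refine le_trans (Finset.sum_le_sum fun n _ => ?_) (AoI.sum_rrTau_le τ0 ht)
      rw [AoI.rrTau_eq_elapsed]
      exact_mod_cast AoI.elapsed_mono (Nat.zero_le (τ0 n)) _ t
    · rw [← AoI.solo_rrSched]
      exact hω n j
  · filter_upwards [hπ'.ae_tendsto_dev hlam hL hπ h0] with ω hω
    refine EReal.ge_of_forall_gt_iff_ge.1 fun b hb => ?_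
    refine le_liminf_of_le (by isBoundedDefault) ?_
    filter_upwards [AoI.eventually_lt_avgAoI hlam hπ h0 hω (EReal.coe_lt_coe_iff.1 hb)] with T hT
    exact_mod_cast hT.le
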